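/- Let $K$ be a field and let $S=\bigoplus_{n\ge 0}S_n$ be a commutative graded $K$-algebra with $S_0=K$, generated over $K$ by finitely many homogeneous elements $u_1,\dots,u_r$ of positive degrees $a_1,\dots,a_r$. Put $D=\operatorname{lcm}(a_1,\dots,a_r)$. Let $M=\bigoplus_{n\ge 0}M_n$ be a finitely generated graded $S$-module of Krull dimension $m\ge 0$ (so $M\neq 0$). Then all $M_n$ are finite-dimensional over $K$; put $H(M,n)=\dim_K M_n$. There are unique functions $d_{M,0},\dots,d_{M,m-1}:\mathbb N\to\mathbb Q$, periodic with period $D$ (that is, $d_{M,k}(n+D)=d_{M,k}(n)$ for all $n\ge 0$), with $d_{M,m-1}\not\equiv 0$ if $m\ge 1$, such that $$H(M,n)=q_M(n):=\sum_{k=0}^{m-1}d_{M,k}(n)\,n^k\quad\text{for all sufficiently large } n .$$ Let $\alpha(M)$ be the least $n_0\in\mathbb N$ such that $H(M,n)=q_M(n)$ for all $n\ge n_0$. For a real number $w>0$ put $$\zeta_M(z,w)=\sum_{n=0}^{\infty}\frac{H(M,n)}{(n+w)^z},\qquad \theta_M(z,w)=\sum_{n=0}^{\alpha(M)-1}\frac{H(M,n)}{(n+w)^z},$$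 and let $\zeta(z,a)$, for $a>0$, denote the Hurwitz zeta function, the meromorphic continuation of $\sum_{n\ge 0}(n+a)^{-z}$. **Theorem 1.1.** For every $w>0$, the function $\theta_M(\cdot,w)$ is entire, the series $\zeta_M(z,w)$ converges absolutely for $\operatorname{Re} z>m$, and it extends to a meromorphic function on $\mathbb C$, still denoted $\zeta_M(z,w)$, which is analytic outside $\{1,2,\dots,m\}$ and satisfies, for all $z\in\mathbb C\setminus\{1,\dots,m\}$, $$\zeta_M(z,w)=\theta_M(z,w)+D^{-z}\sum_{k=0}^{m-1}\sum_{j=0}^{D-1}d_{M,k}(j+\alpha(M))\sum_{\ell=0}^{k}\binom{k}{\ell}(-w)^{\ell}D^{k-\ell}\,\zeta\!\left(z-k+\ell,\frac{j+\alpha(M)+w}{D}\right).$$ Each of the points $1,\dots,m$ is at most a simple pole of $\zeta_M(\cdot,w)$, and $$\operatorname{Res}_{z=k+1}\zeta_M(z,w)=\frac1D\sum_{\ell=k}^{m-1}\binom{\ell}{k}(-w)^{\ell-k}\sum_{j=0}^{D-1}d_{M,\ell}(j),\qquad 0\le k\le m-1 .$$ -/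

import Mathlib

noncomputable section

namespace GradedZeta

/-- The Hilbert function `H(M, n) = dim_K M_n` of a graded module with components `ℳ n`. -/
def hilbertFunction {K M : Type*} [Field K] [AddCommGroup M] [Module K M]
    (ℳ : ℕ → Submodule K M) (n : ℕ) : ℕ :=
  Module.finrank K (ℳ n)

/-- The value at `n` of the expression `d_{m-1}(n) n^{m-1} + ⋯ + d_1(n) n + d_0(n)`. -/
def quasiEval {m : ℕ} (d : Fin m → ℕ → ℚ) (n : ℕ) : ℚ :=
  ∑ k : Fin m, d k n * (n : ℚ) ^ (k : ℕ)

/-- `d_0, …, d_{m-1}` are the coefficients of a quasi-polynomial of degree `m - 1` and period `D`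
(the zero quasi-polynomial if `m = 0`) that agrees with `H` at all large arguments. -/
structure IsHilbertQuasiPolynomial (H : ℕ → ℕ) (D m : ℕ) (d : Fin m → ℕ → ℚ) : Prop where
  periodic : ∀ k : Fin m, Function.Periodic (d k) D
  leading_ne_zero : ∀ k : Fin m, (k : ℕ) + 1 = m → d k ≠ 0
  eventually_eq : ∀ᶠ n : ℕ in Filter.atTop, (H n : ℚ) = quasiEval d n

/-- `α(M)`, the least `n₀` such that `H n = q n` for all `n ≥ n₀`. -/
def alphaIndex (H : ℕ → ℕ) {m : ℕ} (d : Fin m → ℕ → ℚ) : ℕ :=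
  sInf {n₀ : ℕ | ∀ n, n₀ ≤ n → (H n : ℚ) = quasiEval d n}

/-- The `n`-th term `H(n) / (n + w) ^ z` of the zeta series. -/
def zetaTerm (H : ℕ → ℕ) (w : ℝ) (z : ℂ) (n : ℕ) : ℂ :=
  (H n : ℂ) / ((n : ℂ) + (w : ℂ)) ^ z

/-- The finite partial sum `θ(z, w)` of the terms with `n < α`. -/
def theta (H : ℕ → ℕ) (α : ℕ) (w : ℝ) (z : ℂ) : ℂ :=
  ∑ n ∈ Finset.range α, zetaTerm H w z n

/-- The Hurwitz zeta function `ζ(z, a)`, continued to `z ≠ 1`, for an arbitrary real `a > 0`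
(a junk value is taken at the pole `z = 1`).
Mathlib's `hurwitzZeta` only sees `a` modulo `1`; it is the continuation of `∑ 1 / (n + b) ^ z`
for `b ∈ (0, 1]`. With `a = N + b`, `b ∈ (0, 1]`, `N ∈ ℕ`, the first `N` terms are removed. -/
def hurwitz (z : ℂ) (a : ℝ) : ℂ :=
  HurwitzZeta.hurwitzZeta (a : UnitAddCircle) z -
    ∑ i ∈ Finset.range (⌈a⌉₊ - 1), 1 / ((i : ℂ) + ((a - ((⌈a⌉₊ - 1 : ℕ) : ℝ) : ℝ) : ℂ)) ^ z

/-- Near `c`, the Laurent expansion of `F` has principal part `R / (z - c)`: the point `c` is at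
most a simple pole of `F`, and the residue of `F` there is `R`. -/
def HasSimplePoleWithResidue (F : ℂ → ℂ) (c R : ℂ) : Prop :=
  ∃ g : ℂ → ℂ, AnalyticAt ℂ g c ∧ ∀ᶠ z in nhdsWithin c {c}ᶜ, F z = R / (z - c) + g z

end GradedZeta

end

noncomputable section

namespace GradedZeta

/-! ### Krull dimension and Noether normalization for a finite module -/

section KrullDimension

variable {A B : Type*} [CommRing A] [CommRing B]

/-! The Hilbert function is a quasi-polynomial by a Hilbert–Serre induction, its degree is fixed by
counting dimensions, and the zeta series then splits into Hurwitz zeta functions.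

Quasi-polynomiality: multiplication by a homogeneous generator on a graded subquotient of `M` has
kernel and cokernel killed by that generator. Induction on the generators
(`eventually_fwdDiff_iter_finrank_sub`) shows that `(E ^ D - 1) ^ r`, with `E` the shift,
annihilates `H` far out. Newton's formula then makes `H` a polynomial on each residue class modulo
`D`.

Degree: Noether normalization of `S / Ann M` yields a polynomial ring in `m` variables that acts
faithfully on `M`, with `M` finite over it (`exists_mvPolynomial_action`). The action need not
respect the grading, so two filtrations of `M` are compared: by degree, and by the degree of
polynomial coefficients. Each lies in the other up to linear rescaling, so `∑_{n ≤ N} H n` has exact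
order `N ^ m`. The upper bound (`exists_sum_hilbertFunction_le`) forces degree less than `m` on
every class; the lower one (`exists_le_sum_hilbertFunction`) forces the top coefficient to be
nonzero.

Analysis: for `n = j + α + D s` one has `n + w = D (s + a)` with `a = (j + α + w) / D`. Expanding `n
^ k = (D (s + a) - w) ^ k` turns the tail of the series into a finite combination of Hurwitz series
at `z - k + l`. A Hurwitz function has a single pole, at `1`, simple with residue `1`, so poles and
residues follow by linearity. -/

theorem ringKrullDim_eq_of_isIntegral (f : A →+* B) (hf : f.IsIntegral)
    (hinj : Function.Injective f) : ringKrullDim A = ringKrullDim B := by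
  algebraize [f]
  have : Algebra.IsIntegral A B := ⟨hf⟩
  apply le_antisymm
  -- Lying over starts a lifted chain and going up extends it; the condition on last terms is what
  -- makes the extension possible.
  · have lift (p : LTSeries (PrimeSpectrum A)) : ∃ q : LTSeries (PrimeSpectrum B),
        q.length = p.length ∧ q.last.comap f = p.last := by
      induction p using RelSeries.inductionOn' with
      | singleton x =>
        obtain ⟨Q, -, hQ, hQc⟩ := Ideal.exists_ideal_over_prime_of_isIntegral x.asIdeal (⊥ : Ideal B)
          (by
            have : Ideal.comap (algebraMap A B) ⊥ = ⊥ := by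
              rw [← RingHom.ker_eq_comap_bot]
              exact (RingHom.injective_iff_ker_eq_bot f).mp hinj
            rw [this]; exact bot_le)
        exact ⟨RelSeries.singleton _ ⟨Q, hQ⟩, rfl, PrimeSpectrum.ext hQc⟩
      | snoc p x hx ih =>
        obtain ⟨q, hq, hql⟩ := ih
        have hle : Ideal.comap (algebraMap A B) q.last.asIdeal ≤ x.asIdeal := by
          have h1 := congrArg PrimeSpectrum.asIdeal hql
          change Ideal.comap (algebraMap A B) q.last.asIdeal = p.last.asIdeal at h1
          rw [h1]
          exact (show p.last < x from hx).le
        obtain ⟨Q, hQl, hQ, hQc⟩ :=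
          Ideal.exists_ideal_over_prime_of_isIntegral x.asIdeal q.last.asIdeal hle
        have hc : PrimeSpectrum.comap f ⟨Q, hQ⟩ = x := PrimeSpectrum.ext hQc
        have hlt : q.last < (⟨Q, hQ⟩ : PrimeSpectrum B) := by
          refine lt_of_le_of_ne hQl fun h => ?_
          rw [← h, hql] at hc
          exact (show p.last < x from hx).ne hc
        refine ⟨q.snoc ⟨Q, hQ⟩ hlt, ?_, ?_⟩
        · simp [hq]
        · simpa using hc
    refine iSup_le fun p => ?_
    obtain ⟨q, hq, -⟩ := lift p
    rw [← hq]
    exact le_iSup (fun q : LTSeries (PrimeSpectrum B) => (q.length : WithBot ℕ∞)) q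
  -- Incomparability: nested distinct primes of `B` have distinct contractions.
  · refine Order.krullDim_le_of_strictMono (PrimeSpectrum.comap f) fun p q hpq => ?_
    refine lt_of_le_of_ne (Ideal.comap_mono hpq.le) fun h => ?_
    obtain ⟨x, hxq, hxp⟩ := SetLike.exists_of_lt (show p.asIdeal < q.asIdeal from hpq)
    refine (Ideal.comap_lt_comap_of_integral_mem_sdiff (R := A) hpq.le ⟨hxq, hxp⟩
      (Algebra.IsIntegral.isIntegral x)).ne ?_
    exact congrArg PrimeSpectrum.asIdeal h

theorem exists_finite_injective_mvPolynomial {K : Type*} [Field K] [Algebra K A]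
    [Algebra.FiniteType K A] {m : ℕ} (hm : ringKrullDim A = m) :
    ∃ g : MvPolynomial (Fin m) K →ₐ[K] A, Function.Injective g ∧ g.Finite := by
  have : Nontrivial A := by
    by_contra h
    rw [not_nontrivial_iff_subsingleton] at h
    rw [ringKrullDim_eq_bot_of_subsingleton] at hm
    exact absurd hm (by simp)
  obtain ⟨s, g, hg, hfin⟩ := exists_finite_inj_algHom_of_fg K A
  have h := ringKrullDim_eq_of_isIntegral g.toRingHom hfin.to_isIntegral hg
  rw [MvPolynomial.ringKrullDim_of_isNoetherianRing, ringKrullDim_eq_zero_of_field, hm] at h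
  simp only [Nat.card_eq_fintype_card, Fintype.card_fin, zero_add] at h
  obtain rfl : s = m := by exact_mod_cast h
  exact ⟨g, hg, hfin⟩

/-- Noether normalization for the support of a finite module: a polynomial ring in as many variables
as the dimension of `M` acts faithfully on `M`, and `M` is finite over it. -/
theorem exists_mvPolynomial_action (K : Type*) {S : Type*} (M : Type*) [Field K] [CommRing S]
    [Algebra K S] [AddCommGroup M] [Module S M] [Algebra.FiniteType K S] [Module.Finite S M] {m : ℕ}
    (hm : Module.supportDim S M = (m : WithBot ℕ∞)) :
    ∃ ψ : MvPolynomial (Fin m) K →ₐ[K] S, (∀ p, (∀ x : M, ψ p • x = 0) → p = 0) ∧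
      ∃ (t : ℕ) (e : Fin t → M),
        ∀ x, ∃ c : Fin t → MvPolynomial (Fin m) K, ∑ l, ψ (c l) • e l = x := by
  rw [Module.supportDim_eq_ringKrullDim_quotient_annihilator] at hm
  set I := Module.annihilator S M
  obtain ⟨φ, hφ, hfin⟩ := exists_finite_injective_mvPolynomial (K := K) hm
  -- Arbitrary lifts to `S` of the normalizing variables of `S ⧸ I` define the action; nothing makes
  -- them homogeneous.
  choose s hs using fun i => Ideal.Quotient.mk_surjective (φ (MvPolynomial.X i))
  have hcomp : ∀ p, Ideal.Quotient.mk I (MvPolynomial.aeval s p) = φ p := by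
    intro p
    have : (Ideal.Quotient.mkₐ K I).comp (MvPolynomial.aeval s) = φ :=
      MvPolynomial.algHom_ext fun i => by simpa using hs i
    exact DFunLike.congr_fun this p
  refine ⟨MvPolynomial.aeval s, fun p hp => hφ ?_, ?_⟩
  · rw [← hcomp, map_zero, Ideal.Quotient.eq_zero_iff_mem]
    exact Module.mem_annihilator.2 hp
  · algebraize [φ.toRingHom]
    have : Module.Finite (MvPolynomial (Fin m) K) (S ⧸ I) := hfin
    obtain ⟨q, f, hf⟩ := Module.Finite.exists_fin (R := MvPolynomial (Fin m) K) (M := S ⧸ I)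
    obtain ⟨t, e, he⟩ := Module.Finite.exists_fin (R := S) (M := M)
    choose f' hf' using fun j => Ideal.Quotient.mk_surjective (f j)
    -- The expansion of `z` over the polynomial ring holds only modulo `I`, but `I` annihilates `M`,
    -- so it is exact on `M`.
    have key : ∀ (z : S), ∃ c : Fin q → MvPolynomial (Fin m) K, ∀ x : M,
        z • x = ∑ j, MvPolynomial.aeval s (c j) • f' j • x := by
      intro z
      have hz : Ideal.Quotient.mk I z ∈ Submodule.span (MvPolynomial (Fin m) K) (Set.range f) :=
        hf ▸ Submodule.mem_top
      obtain ⟨c, hc⟩ := (Submodule.mem_span_range_iff_exists_fun _).1 hz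
      refine ⟨c, fun x => ?_⟩
      have h1 : z - ∑ j, MvPolynomial.aeval s (c j) * f' j ∈ I := by
        rw [← Ideal.Quotient.eq_zero_iff_mem, map_sub, map_sum, ← hc, sub_eq_zero]
        refine Finset.sum_congr rfl fun j _ => ?_
        rw [map_mul, hcomp, hf', Algebra.smul_def]
        rfl
      have h2 := Module.mem_annihilator.1 h1 x
      rw [sub_smul, sub_eq_zero, Finset.sum_smul] at h2
      simpa only [mul_smul] using h2
    choose c hc using key
    refine ⟨t * q, fun l => f' (finProdFinEquiv.symm l).2 • e (finProdFinEquiv.symm l).1,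
      fun x => ?_⟩
    have hx : x ∈ Submodule.span S (Set.range e) := he ▸ Submodule.mem_top
    obtain ⟨z, rfl⟩ := (Submodule.mem_span_range_iff_exists_fun _).1 hx
    refine ⟨fun l => c (z (finProdFinEquiv.symm l).1) (finProdFinEquiv.symm l).2, ?_⟩
    rw [Equiv.sum_comp finProdFinEquiv.symm (fun l : Fin t × Fin q =>
      MvPolynomial.aeval s (c (z l.1) l.2) • f' l.2 • e l.1), Fintype.sum_prod_type]
    exact Finset.sum_congr rfl fun l _ => (hc (z l) (e l)).symm

end KrullDimension

/-! ### Difference equations, quasi-polynomials and growth -/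

section QuasiPolynomial

open Filter Polynomial

/-- With `D = a c`, the operator `E ^ D - 1` factors as `(∑_{i < c} E ^ (a i)) (E ^ a - 1)`, so one
more factor `E ^ D - 1` absorbs `E ^ a - 1`. -/
theorem eventually_fwdDiff_iter_succ_eq_zero {a D s : ℕ} (h : a ∣ D) {g : ℕ → ℚ}
    (hg : ∀ᶠ n in atTop, (fwdDiff D)^[s] (fwdDiff a g) n = 0) :
    ∀ᶠ n in atTop, (fwdDiff D)^[s + 1] g n = 0 := by
  obtain ⟨c, rfl⟩ := h
  obtain ⟨N, hN⟩ := eventually_atTop.1 hg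
  have key : fwdDiff (a * c) g = ∑ i ∈ Finset.range c, fun n => fwdDiff a g (n + a * i) := by
    ext n
    rw [Finset.sum_apply]
    simp only [fwdDiff, add_assoc, ← mul_add_one]
    rw [Finset.sum_range_sub (fun i => g (n + a * i))]
    simp
  refine eventually_atTop.2 ⟨N, fun n hn => ?_⟩
  rw [Function.iterate_succ_apply, key, fwdDiff_iter_finsetSum, Finset.sum_apply]
  refine Finset.sum_eq_zero fun i _ => ?_
  rw [fwdDiff_iter_comp_add]
  exact hN _ (by omega)

theorem exists_polynomial_of_fwdDiff_iter_eq_zero {D r : ℕ} (hD : 0 < D) {g : ℕ → ℚ}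
    (hg : ∀ᶠ n in atTop, (fwdDiff D)^[r] g n = 0) (j : ℕ) :
    ∃ p : ℚ[X], ∀ᶠ n : ℕ in atTop, n % D = j % D → g n = p.eval (n : ℚ) := by
  obtain ⟨N, hN⟩ := eventually_atTop.1 hg
  have hk : ∀ k, r ≤ k → ∀ y, N ≤ y → (fwdDiff D)^[k] g y = 0 := by
    intro k hk
    induction k, hk using Nat.le_induction with
    | base => exact hN
    | succ k _ ih =>
      intro y hy
      rw [Function.iterate_succ_apply', fwdDiff, ih _ hy, ih _ (by omega), sub_zero]
  -- Base point of the Newton expansion: in the class of `j`, and late enough for the differences of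
  -- order at least `r` to vanish.
  set y := j % D + D * N with hy
  have hyN : N ≤ y := (Nat.le_mul_of_pos_left N hD).trans (Nat.le_add_left _ _)
  refine ⟨∑ k ∈ Finset.range r, C ((fwdDiff D)^[k] g y / (k.factorial : ℚ)) *
    (descPochhammer ℚ k).comp (C ((D : ℚ)⁻¹) * (X - C (y : ℚ))), ?_⟩
  refine eventually_atTop.2 ⟨y, fun n hn hnj => ?_⟩
  obtain ⟨t, rfl⟩ : ∃ t, n = y + t * D := by
    have h1 : y % D = n % D := by simp [hy, hnj]
    obtain ⟨t, ht⟩ := (Nat.modEq_iff_dvd' hn).1 h1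
    exact ⟨t, by rw [mul_comm, ← ht]; omega⟩
  have hD' : (D : ℚ) ≠ 0 := by positivity
  rw [← smul_eq_mul t D, shift_eq_sum_fwdDiff_iter D g t y, eval_finsetSum]
  have harg : (D : ℚ)⁻¹ * (((y + t • D : ℕ) : ℚ) - y) = t := by
    push_cast [smul_eq_mul]; field_simp; ring
  have h1 : ∀ k, eval ((y + t • D : ℕ) : ℚ) (C ((fwdDiff D)^[k] g y / (k.factorial : ℚ)) *
      (descPochhammer ℚ k).comp (C ((D : ℚ)⁻¹) * (X - C (y : ℚ)))) =
      t.choose k • (fwdDiff D)^[k] g y := by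
    intro k
    rw [eval_mul, eval_comp, eval_mul, eval_sub, eval_C, eval_C, eval_X, eval_C, harg, nsmul_eq_mul,
      Nat.cast_choose_eq_descPochhammer_div]
    ring
  rw [Finset.sum_congr rfl fun k _ => h1 k]
  -- Both ranges are padded to a common one: the binomials vanish for `k > t`, the differences for
  -- `k ≥ r`.
  trans ∑ k ∈ Finset.range (t + 1 + r), t.choose k • (fwdDiff D)^[k] g y
  · refine Finset.sum_subset (Finset.range_mono (by omega)) fun k _ hk' => ?_
    rw [Nat.choose_eq_zero_of_lt (by simpa using hk'), zero_smul]
  · refine (Finset.sum_subset (Finset.range_mono (by omega)) fun k _ hk' => ?_).symm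
    rw [hk k (by simpa using hk') y hyN, smul_zero]

/-- Degree at least `m` would give `H n ≥ n ^ m / c'` far out on one class. The `T` terms with `T ≤
s < 2 T` would then contribute order `T ^ (m + 1)`, against the bound of order `T ^ m`. -/
theorem degree_lt_of_sum_le {H : ℕ → ℚ} (hH : ∀ n, 0 ≤ H n) {D m j : ℕ} (hj : j < D) {B : ℚ}
    (hB : ∀ N : ℕ, ∑ n ∈ Finset.range (N + 1), H n ≤ B * (N + 1) ^ m) {p : ℚ[X]}
    (hp : ∀ᶠ n : ℕ in atTop, n % D = j → H n = p.eval (n : ℚ)) : p.degree < m := by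
  by_contra! hdeg
  have hO := Polynomial.isBigO_atTop_of_degree_le (𝕜 := ℚ) (X ^ m) p (by rwa [degree_X_pow])
  obtain ⟨c, hc, hO⟩ := (hO.comp_tendsto tendsto_natCast_atTop_atTop).exists_pos
  obtain ⟨n₁, hn₁⟩ := eventually_atTop.1 (hp.and hO.bound)
  have hDQ : (0 : ℚ) < D := by exact_mod_cast (by omega : 0 < D)
  obtain ⟨c', hcc'⟩ := exists_rat_gt c
  have hc' : 0 < c' := by exact_mod_cast hc.trans hcc'
  have hlow : ∀ n, n₁ ≤ n → n % D = j → (n : ℚ) ^ m ≤ c' * H n := by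
    intro n hn hnj
    obtain ⟨h1, h2⟩ := hn₁ n hn
    simp only [Function.comp_apply, eval_pow, eval_X, ← h1 hnj] at h2
    rw [← Rat.norm_cast_real, ← Rat.norm_cast_real, Real.norm_of_nonneg (by positivity),
      Real.norm_of_nonneg (by exact_mod_cast hH n)] at h2
    have h3 : (((n : ℚ) ^ m : ℚ) : ℝ) ≤ (c' : ℝ) * (H n : ℝ) :=
      h2.trans (mul_le_mul_of_nonneg_right hcc'.le (by exact_mod_cast hH n))
    exact_mod_cast h3
  have key : ∀ T : ℕ, n₁ ≤ T → 1 ≤ T → (T : ℚ) ≤ c' * (B * 3 ^ m) := by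
    intro T hT hT1
    have hT0 : (1 : ℚ) ≤ T := by exact_mod_cast hT1
    have hD1 : (1 : ℚ) ≤ D := by exact_mod_cast (by omega : 1 ≤ D)
    have hB0 : 0 ≤ B := by
      have := hB 0
      simp only [zero_add, Finset.range_one, Finset.sum_singleton, Nat.cast_zero, one_pow,
        mul_one] at this
      exact (hH 0).trans this
    have hpos : (0 : ℚ) < (D * T) ^ m := by positivity
    have h1 : (T : ℚ) * (D * T) ^ m ≤ ∑ s ∈ Finset.Ico T (2 * T), c' * H (j + D * s) := by
      have : ∑ s ∈ Finset.Ico T (2 * T), ((D : ℚ) * T) ^ m = T * (D * T) ^ m := by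
        rw [Finset.sum_const, Nat.card_Ico, nsmul_eq_mul]
        congr 2
        omega
      rw [← this]
      refine Finset.sum_le_sum fun s hs => ?_
      rw [Finset.mem_Ico] at hs
      refine le_trans ?_ (hlow (j + D * s) ?_ ?_)
      · have : (T : ℚ) ≤ s := by exact_mod_cast hs.1
        push_cast
        gcongr
        nlinarith [(Nat.cast_nonneg j : (0 : ℚ) ≤ j)]
      · nlinarith [hs.1]
      · rw [Nat.add_mul_mod_self_left, Nat.mod_eq_of_lt hj]
    have h2 : ∑ s ∈ Finset.Ico T (2 * T), H (j + D * s) ≤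
        ∑ n ∈ Finset.range (2 * D * T + 1), H n := by
      rw [← Finset.sum_image (f := H) (g := fun s => j + D * s)]
      · refine Finset.sum_le_sum_of_subset_of_nonneg ?_ fun n _ _ => hH n
        intro n hn
        simp only [Finset.mem_image, Finset.mem_Ico] at hn
        obtain ⟨s, hs, rfl⟩ := hn
        rw [Finset.mem_range]
        nlinarith [hs.2]
      · intro s _ s' _ h
        have h' : D * s = D * s' := by simpa using h
        exact Nat.eq_of_mul_eq_mul_left (by omega) h'
    rw [← Finset.mul_sum] at h1
    -- The factor `3` comes from `2 D T + 1 ≤ 3 D T`.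
    have h3 : B * (((2 * D * T : ℕ) : ℚ) + 1) ^ m ≤ B * (3 ^ m * (D * T) ^ m) := by
      rw [← mul_pow]
      gcongr
      push_cast
      nlinarith
    have h4 : (T : ℚ) * (D * T) ^ m ≤ (c' * (B * 3 ^ m)) * (D * T) ^ m :=
      calc _ ≤ _ := h1
        _ ≤ c' * (B * (3 ^ m * (D * T) ^ m)) :=
          mul_le_mul_of_nonneg_left (h2.trans ((hB _).trans h3)) hc'.le
        _ = _ := by ring
    exact le_of_mul_le_mul_right h4 hpos
  obtain ⟨T, hT⟩ := exists_nat_gt (c' * (B * 3 ^ m))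
  have h5 := key (max (max n₁ 1) T) (by simp) (by simp)
  have h6 : (T : ℚ) ≤ (max (max n₁ 1) T : ℕ) := by exact_mod_cast le_max_right _ _
  linarith

theorem exists_bound_of_periodic {D : ℕ} (hD : 0 < D) {f : ℕ → ℚ} (hf : Function.Periodic f D) :
    ∃ B, 0 ≤ B ∧ ∀ n, |f n| ≤ B := by
  refine ⟨∑ j ∈ Finset.range D, |f j|, Finset.sum_nonneg fun _ _ => abs_nonneg _, fun n => ?_⟩
  rw [← hf.map_mod_nat n]
  exact Finset.single_le_sum (f := fun j => |f j|) (fun _ _ => abs_nonneg _)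
    (Finset.mem_range.2 (Nat.mod_lt n hD))

/-- Without its top coefficient `H` is bounded by terms `n ^ k` with `k < m` beyond finitely many
arguments, so its partial sums are `O(N ^ m)`, too small for the assumed growth. -/
theorem leading_ne_zero_of_le_sum {H : ℕ → ℚ} (hH : ∀ n, 0 ≤ H n) {D m : ℕ} (hD : 0 < D)
    {B : ℚ} {c b : ℕ}
    (hB : ∀ N : ℕ, ((N : ℚ) + 1) ^ (m + 1) ≤ B * ∑ n ∈ Finset.range (c * N + b + 1), H n)
    {d : Fin (m + 1) → ℕ → ℚ} (hd : ∀ k, Function.Periodic (d k) D)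
    (heq : ∀ᶠ n in atTop, H n = quasiEval d n) : d (Fin.last m) ≠ 0 := by
  intro h0
  choose β hβ0 hβ using fun k => exists_bound_of_periodic hD (hd k)
  obtain ⟨n₀, hn₀⟩ := eventually_atTop.1 heq
  set A := ∑ n ∈ Finset.range n₀, H n
  have hA0 : 0 ≤ A := Finset.sum_nonneg fun n _ => hH n
  have hpt : ∀ n, H n ≤ (if n < n₀ then H n else 0) +
      ∑ k : Fin m, β k.castSucc * (n : ℚ) ^ (k : ℕ) := by
    intro n
    have hnn : 0 ≤ ∑ k : Fin m, β k.castSucc * (n : ℚ) ^ (k : ℕ) :=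
      Finset.sum_nonneg fun k _ => mul_nonneg (hβ0 _) (by positivity)
    split_ifs with h
    · linarith
    · rw [hn₀ n (not_lt.1 h), quasiEval, Fin.sum_univ_castSucc, h0]
      simp only [Fin.val_castSucc, Pi.zero_apply, zero_mul, add_zero, zero_add]
      refine Finset.sum_le_sum fun k _ => ?_
      gcongr
      exact (le_abs_self _).trans (hβ _ _)
  set A' := A + ∑ k : Fin m, β k.castSucc
  have hA' : 0 ≤ A' := add_nonneg hA0 (Finset.sum_nonneg fun k _ => hβ0 _)
  have hsum : ∀ N : ℕ, ∑ n ∈ Finset.range (N + 1), H n ≤ A' * (N + 1) ^ m := by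
    intro N
    have h1 : ∑ n ∈ Finset.range (N + 1), (if n < n₀ then H n else 0) ≤ A := by
      rw [← Finset.sum_filter]
      refine Finset.sum_le_sum_of_subset_of_nonneg (fun n hn => ?_) fun n _ _ => hH n
      exact Finset.mem_range.2 (Finset.mem_filter.1 hn).2
    have h2 : ∑ n ∈ Finset.range (N + 1), ∑ k : Fin m, β k.castSucc * (n : ℚ) ^ (k : ℕ) ≤
        ∑ k : Fin m, β k.castSucc * ((N : ℚ) + 1) ^ m := by
      rw [Finset.sum_comm]
      refine Finset.sum_le_sum fun k _ => ?_
      rw [← Finset.mul_sum]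
      refine mul_le_mul_of_nonneg_left ?_ (hβ0 _)
      calc ∑ n ∈ Finset.range (N + 1), (n : ℚ) ^ (k : ℕ)
          ≤ ∑ n ∈ Finset.range (N + 1), ((N : ℚ) + 1) ^ (k : ℕ) := by
            refine Finset.sum_le_sum fun n hn => ?_
            have : (n : ℚ) ≤ N + 1 := by exact_mod_cast (Finset.mem_range.1 hn).le
            gcongr
        _ = ((N : ℚ) + 1) ^ ((k : ℕ) + 1) := by
            rw [Finset.sum_const, Finset.card_range, nsmul_eq_mul, pow_succ']
            push_cast; ring
        _ ≤ ((N : ℚ) + 1) ^ m :=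
            pow_le_pow_right₀ (by linarith [(Nat.cast_nonneg N : (0 : ℚ) ≤ N)]) k.2
    have h3 : A ≤ A * ((N : ℚ) + 1) ^ m :=
      le_mul_of_one_le_right hA0 (one_le_pow₀ (by linarith [(Nat.cast_nonneg N : (0 : ℚ) ≤ N)]))
    calc _ ≤ ∑ n ∈ Finset.range (N + 1), ((if n < n₀ then H n else 0) +
          ∑ k : Fin m, β k.castSucc * (n : ℚ) ^ (k : ℕ)) := Finset.sum_le_sum fun n _ => hpt n
      _ ≤ A + ∑ k : Fin m, β k.castSucc * ((N : ℚ) + 1) ^ m := by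
        rw [Finset.sum_add_distrib]; exact add_le_add h1 h2
      _ ≤ A' * (N + 1) ^ m := by
        have h4 : A' * ((N : ℚ) + 1) ^ m = A * (N + 1) ^ m + (∑ k : Fin m, β k.castSucc) * (N + 1) ^ m :=
          add_mul _ _ _
        rw [h4, ← Finset.sum_mul]
        linarith
  have hB0 : 0 ≤ B := by
    by_contra! hneg
    have h1 := hB 0
    have h2 : (0 : ℚ) ≤ ∑ n ∈ Finset.range (c * 0 + b + 1), H n :=
      Finset.sum_nonneg fun n _ => hH n
    simp only [Nat.cast_zero, zero_add, one_pow] at h1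
    nlinarith
  -- Uses `c N + b + 1 ≤ (c + b + 1) (N + 1)`.
  have key : ∀ N : ℕ, (N : ℚ) + 1 ≤ B * (A' * (c + b + 1) ^ m) := by
    intro N
    have hN : (0 : ℚ) ≤ N := Nat.cast_nonneg N
    have hpos : (0 : ℚ) < ((N : ℚ) + 1) ^ m := by positivity
    refine le_of_mul_le_mul_right ?_ hpos
    calc ((N : ℚ) + 1) * (N + 1) ^ m = (N + 1) ^ (m + 1) := by ring
      _ ≤ _ := hB N
      _ ≤ B * (A' * (((c * N + b : ℕ) : ℚ) + 1) ^ m) := mul_le_mul_of_nonneg_left (hsum _) hB0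
      _ ≤ B * (A' * (((c : ℚ) + b + 1) * (N + 1)) ^ m) := by
        gcongr
        push_cast
        nlinarith [mul_nonneg (Nat.cast_nonneg b : (0 : ℚ) ≤ b) hN, (Nat.cast_nonneg c : (0 : ℚ) ≤ c)]
      _ = _ := by rw [mul_pow]; ring
  obtain ⟨N, hN⟩ := exists_nat_gt (B * (A' * (c + b + 1) ^ m))
  linarith [key N]

/-- Along `n₀ + D ℕ` the coefficients are constant, so both sides are honest polynomials agreeing at
infinitely many points. -/
theorem eq_of_eventually_quasiEval_eq {D m : ℕ} (hD : 0 < D) {d e : Fin m → ℕ → ℚ}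
    (hd : ∀ k, Function.Periodic (d k) D) (he : ∀ k, Function.Periodic (e k) D)
    (h : ∀ᶠ n in atTop, quasiEval d n = quasiEval e n) : d = e := by
  ext k n₀
  obtain ⟨N, hN⟩ := eventually_atTop.1 h
  have key : (∑ i : Fin m, C (d i n₀) * X ^ (i : ℕ) : ℚ[X]) =
      ∑ i : Fin m, C (e i n₀) * X ^ (i : ℕ) := by
    refine Polynomial.eq_of_infinite_eval_eq _ _ ?_
    refine Set.infinite_of_injective_forall_mem
      (f := fun t : ℕ => ((n₀ + (t + N) * D : ℕ) : ℚ)) (fun s t hst => ?_) fun t => ?_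
    · have h1 : (s + N) * D = (t + N) * D := by
        have := Nat.cast_injective (R := ℚ) hst
        omega
      have := Nat.eq_of_mul_eq_mul_right hD h1
      omega
    · have h1 := hN (n₀ + (t + N) * D) (by nlinarith)
      simp only [quasiEval] at h1
      simp only [Set.mem_ofPred_eq, eval_finsetSum, eval_mul, eval_C, eval_pow, eval_X]
      convert h1 using 3 with i _ i _
      · exact (((hd i).nat_mul (t + N)) n₀).symm
      · exact (((he i).nat_mul (t + N)) n₀).symm
  have h2 := congrArg (fun p : ℚ[X] => p.coeff k) key
  simpa [Polynomial.coeff_X_pow, Fin.val_inj] using h2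

theorem existsUnique_isHilbertQuasiPolynomial {H : ℕ → ℕ} {D m r : ℕ} (hD : 0 < D)
    (hrec : ∀ᶠ n in atTop, (fwdDiff D)^[r] (fun n => (H n : ℚ)) n = 0)
    (hupper : ∃ B : ℕ, ∀ N, ∑ n ∈ Finset.range (N + 1), H n ≤ B * (N + 1) ^ m)
    (hlower : ∃ B c b : ℕ, ∀ N, (N + 1) ^ m ≤ B * ∑ n ∈ Finset.range (c * N + b + 1), H n) :
    ∃! d : Fin m → ℕ → ℚ, IsHilbertQuasiPolynomial H D m d := by
  have hH : ∀ n, (0 : ℚ) ≤ (H n : ℚ) := fun n => Nat.cast_nonneg _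
  choose p hp using exists_polynomial_of_fwdDiff_iter_eq_zero hD hrec
  have hpdeg : ∀ j < D, (p j).degree < m := by
    intro j hj
    obtain ⟨B, hB⟩ := hupper
    refine degree_lt_of_sum_le (B := B) hH hj (fun N => by exact_mod_cast hB N) ?_
    filter_upwards [hp j] with n hn hnj
    exact hn (by rw [hnj, Nat.mod_eq_of_lt hj])
  set d : Fin m → ℕ → ℚ := fun k n => (p (n % D)).coeff k
  have hd : ∀ k, Function.Periodic (d k) D := fun k n => by simp [d]
  have heq : ∀ᶠ n : ℕ in atTop, (H n : ℚ) = quasiEval d n := by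
    have := (Filter.eventually_all_finset (Finset.range D)).2 fun j _ => hp j
    filter_upwards [this] with n hn
    have hlt := Nat.mod_lt n hD
    rw [hn (n % D) (Finset.mem_range.2 hlt) (Nat.mod_mod n D).symm, quasiEval]
    have hdeg := hpdeg _ hlt
    rcases eq_or_ne (p (n % D)) 0 with h0 | h0
    · simp [d, h0]
    · rw [eval_eq_sum_range' ((natDegree_lt_iff_degree_lt h0).2 hdeg), Finset.sum_range]
  refine ⟨d, ⟨hd, ?_, heq⟩, fun e he => ?_⟩
  · intro k hk
    obtain ⟨m', rfl⟩ : ∃ m', m = m' + 1 := ⟨k, hk.symm⟩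
    obtain rfl : k = Fin.last m' := Fin.ext (by simpa using hk)
    obtain ⟨B, c, b, hB⟩ := hlower
    exact leading_ne_zero_of_le_sum (B := B) (c := c) (b := b) hH hD
      (fun N => by exact_mod_cast hB N) hd heq
  · refine eq_of_eventually_quasiEval_eq hD he.periodic hd ?_
    filter_upwards [he.eventually_eq, heq] with n h1 h2
    rw [← h1, h2]

end QuasiPolynomial

/-! ### Simple poles, Hurwitz zeta functions and the continuation -/

section Zeta

open Filter Topology

namespace HasSimplePoleWithResidue

variable {F G : ℂ → ℂ} {c R R' : ℂ}

theorem of_analyticAt (hF : AnalyticAt ℂ F c) : HasSimplePoleWithResidue F c 0 :=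
  ⟨F, hF, Eventually.of_forall fun z => by simp⟩

theorem add (hF : HasSimplePoleWithResidue F c R) (hG : HasSimplePoleWithResidue G c R') :
    HasSimplePoleWithResidue (fun z => F z + G z) c (R + R') := by
  obtain ⟨f, hf, hFf⟩ := hF
  obtain ⟨g, hg, hGg⟩ := hG
  refine ⟨fun z => f z + g z, hf.add hg, ?_⟩
  filter_upwards [hFf, hGg] with z h1 h2
  rw [h1, h2]
  ring

theorem sum {ι : Type*} (s : Finset ι) {F : ι → ℂ → ℂ} {R : ι → ℂ}
    (h : ∀ i ∈ s, HasSimplePoleWithResidue (F i) c (R i)) :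
    HasSimplePoleWithResidue (fun z => ∑ i ∈ s, F i z) c (∑ i ∈ s, R i) := by
  classical
  induction s using Finset.induction_on with
  | empty => simpa using of_analyticAt analyticAt_const
  | insert i s hi ih =>
    simp only [Finset.sum_insert hi]
    exact (h i (Finset.mem_insert_self i s)).add
      (ih fun j hj => h j (Finset.mem_insert_of_mem hj))

theorem analyticAt_mul {h : ℂ → ℂ} (hh : AnalyticAt ℂ h c) (hF : HasSimplePoleWithResidue F c R) :
    HasSimplePoleWithResidue (fun z => h z * F z) c (h c * R) := by
  obtain ⟨f, hf, hFf⟩ := hF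
  have hslope : AnalyticAt ℂ (dslope h c) c := by
    obtain ⟨p, hp⟩ := hh
    exact ⟨_, hp.has_fpower_series_dslope_fslope⟩
  -- `h z * R / (z - c)` is `h c * R / (z - c)` plus `R` times the difference quotient of `h`, which
  -- extends analytically to `c`.
  refine ⟨fun z => R * dslope h c z + h z * f z, (analyticAt_const.mul hslope).add (hh.mul hf), ?_⟩
  filter_upwards [hFf, self_mem_nhdsWithin] with z hz hzc
  have hzc' : z - c ≠ 0 := sub_ne_zero.2 hzc
  rw [hz, dslope_of_ne _ hzc, slope_def_field]
  field_simp
  ring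

theorem const_mul (a : ℂ) (hF : HasSimplePoleWithResidue F c R) :
    HasSimplePoleWithResidue (fun z => a * F z) c (a * R) :=
  analyticAt_mul (h := fun _ => a) analyticAt_const hF

theorem comp_add_const (b : ℂ) (hF : HasSimplePoleWithResidue F (c + b) R) :
    HasSimplePoleWithResidue (fun z => F (z + b)) c R := by
  obtain ⟨f, hf, hFf⟩ := hF
  have hana : AnalyticAt ℂ (fun z : ℂ => z + b) c := analyticAt_id.add analyticAt_const
  refine ⟨fun z => f (z + b), AnalyticAt.fun_comp (g := f) hf hana, ?_⟩
  have htend : Tendsto (fun z : ℂ => z + b) (𝓝[≠] c) (𝓝[≠] (c + b)) := by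
    refine tendsto_nhdsWithin_iff.2 ⟨(hana.continuousAt.tendsto).mono_left nhdsWithin_le_nhds, ?_⟩
    filter_upwards [self_mem_nhdsWithin] with z hz h
    exact hz (add_right_cancel h)
  filter_upwards [htend.eventually hFf] with z hz
  rw [hz, add_sub_add_right_eq_sub]

theorem meromorphicAt (hF : HasSimplePoleWithResidue F c R) : MeromorphicAt F c := by
  obtain ⟨f, hf, hFf⟩ := hF
  have h : MeromorphicAt (fun z => R / (z - c) + f z) c :=
    ((MeromorphicAt.const R c).div
      ((MeromorphicAt.id c).sub (MeromorphicAt.const c c))).add hf.meromorphicAt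
  exact h.congr (hFf.mono fun z hz => hz.symm)

end HasSimplePoleWithResidue

/-- Subtracting `⌈a⌉₊ - 1` rather than the floor sends an integer `a` to `1`, never to `0`. -/
theorem sub_ceil_pred_mem {a : ℝ} (ha : 0 < a) : a - ((⌈a⌉₊ - 1 : ℕ) : ℝ) ∈ Set.Ioc (0 : ℝ) 1 := by
  have h1 : 1 ≤ ⌈a⌉₊ := Nat.one_le_ceil_iff.2 ha
  rw [Nat.cast_sub h1]
  have h2 := Nat.le_ceil a
  have h3 := Nat.ceil_lt_add_one ha.le
  constructor <;> push_cast <;> linarith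

theorem analyticAt_const_cpow {b : ℂ} (hb : b ≠ 0) (z : ℂ) : AnalyticAt ℂ (fun z => b ^ z) z := by
  have : Differentiable ℂ fun z : ℂ => b ^ z := fun z =>
    differentiableAt_id.const_cpow (Or.inl hb)
  exact this.analyticAt z

theorem analyticAt_hurwitz_correction {a : ℝ} (ha : 0 < a) (z : ℂ) :
    AnalyticAt ℂ (fun z => ∑ i ∈ Finset.range (⌈a⌉₊ - 1),
      1 / ((i : ℂ) + ((a - ((⌈a⌉₊ - 1 : ℕ) : ℝ) : ℝ) : ℂ)) ^ z) z := by
  refine Finset.analyticAt_fun_sum _ fun i _ => ?_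
  have hb : ((i : ℂ) + ((a - ((⌈a⌉₊ - 1 : ℕ) : ℝ) : ℝ) : ℂ)) ≠ 0 := by
    have h := (sub_ceil_pred_mem ha).1
    have : (0 : ℝ) < i + (a - ((⌈a⌉₊ - 1 : ℕ) : ℝ)) := by positivity
    exact_mod_cast this.ne'
  exact analyticAt_const.div (analyticAt_const_cpow hb z) fun h => hb ((Complex.cpow_eq_zero_iff _ _).1 h).1

theorem analyticAt_hurwitz {a : ℝ} (ha : 0 < a) {z : ℂ} (hz : z ≠ 1) :
    AnalyticAt ℂ (fun z => hurwitz z a) z := by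
  refine AnalyticAt.sub ?_ (analyticAt_hurwitz_correction ha z)
  rw [Complex.analyticAt_iff_eventually_differentiableAt]
  filter_upwards [isOpen_ne.mem_nhds hz] with s hs
  exact HurwitzZeta.differentiableAt_hurwitzZeta _ hs

/-- `hurwitzZeta` minus `1 / (s - 1) / Gammaℝ s` is analytic at `1`, and `Gammaℝ 1 = 1`; the removed
terms are analytic there and do not alter the residue. -/
theorem hurwitz_hasSimplePole {a : ℝ} (ha : 0 < a) :
    HasSimplePoleWithResidue (fun z => hurwitz z a) 1 1 := by
  have hG : AnalyticAt ℂ (fun s => (Complex.Gammaℝ s)⁻¹) 1 :=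
    Complex.differentiable_Gammaℝ_inv.analyticAt 1
  have h1 : HasSimplePoleWithResidue (fun s : ℂ => 1 / (s - 1)) 1 1 :=
    ⟨0, analyticAt_const, Eventually.of_forall fun z => by simp⟩
  have h2 := HasSimplePoleWithResidue.analyticAt_mul hG h1
  have h3 : AnalyticAt ℂ (fun s => HurwitzZeta.hurwitzZeta (a : UnitAddCircle) s -
      1 / (s - 1) / Complex.Gammaℝ s) 1 := by
    rw [Complex.analyticAt_iff_eventually_differentiableAt]
    have hne : ∀ᶠ s in 𝓝 (1 : ℂ), s ∈ {s : ℂ | 0 < s.re} :=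
      (isOpen_lt continuous_const Complex.continuous_re).mem_nhds (by simp)
    filter_upwards [hne] with s hs
    rcases eq_or_ne s 1 with rfl | hs1
    · exact HurwitzZeta.differentiableAt_hurwitzZeta_sub_one_div _
    · refine (HurwitzZeta.differentiableAt_hurwitzZeta _ hs1).sub ?_
      simp only [div_eq_mul_inv]
      refine DifferentiableAt.mul ?_ (Complex.differentiable_Gammaℝ_inv s)
      exact (differentiableAt_const _).mul
        ((differentiableAt_id.sub_const 1).inv (sub_ne_zero.2 hs1))
  have h4 := (h2.add (.of_analyticAt h3)).add
    (.of_analyticAt (analyticAt_hurwitz_correction ha 1).neg)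
  rw [Complex.Gammaℝ_one] at h4
  convert h4 using 1
  · ext z
    simp only [hurwitz, Pi.neg_apply]
    ring
  · simp

theorem hasSum_hurwitz {a : ℝ} (ha : 0 < a) {z : ℂ} (hz : 1 < z.re) :
    HasSum (fun n : ℕ => 1 / ((n : ℂ) + (a : ℂ)) ^ z) (hurwitz z a) := by
  have hb := sub_ceil_pred_mem ha
  have h1 := HurwitzZeta.hasSum_hurwitzZeta_of_one_lt_re (Set.Ioc_subset_Icc_self hb) hz
  have hcirc : ((a - ((⌈a⌉₊ - 1 : ℕ) : ℝ) : ℝ) : UnitAddCircle) = (a : UnitAddCircle) := by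
    rw [AddCircle.coe_sub, sub_eq_self, AddCircle.coe_eq_zero_iff]
    exact ⟨(⌈a⌉₊ - 1 : ℕ), by simp⟩
  rw [hcirc] at h1
  have h2 := (hasSum_nat_add_iff' (⌈a⌉₊ - 1)).2 h1
  have h3 : (fun n : ℕ => 1 / ((n : ℂ) + (a : ℂ)) ^ z) = fun n : ℕ =>
      1 / (((n + (⌈a⌉₊ - 1) : ℕ) : ℂ) + ((a - ((⌈a⌉₊ - 1 : ℕ) : ℝ) : ℝ) : ℂ)) ^ z := by
    ext n
    congr 2
    push_cast
    ring
  rw [h3]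
  exact h2

theorem hasSum_of_hasSum_residue {D : ℕ} (hD : 0 < D) {f : ℕ → ℂ} {g : ℕ → ℂ}
    (h : ∀ j ∈ Finset.range D, HasSum (fun s => f (j + D * s)) (g j)) :
    HasSum f (∑ j ∈ Finset.range D, g j) := by
  have h1 : ∀ j ∈ Finset.range D, HasSum (fun n => if n % D = j then f n else 0) (g j) := by
    intro j hj
    have hinj : Function.Injective fun s => j + D * s := fun s t hst =>
      Nat.eq_of_mul_eq_mul_left hD (by simpa using hst)
    rw [← hinj.hasSum_iff]
    · convert h j hj using 2 with s
      simp [Nat.mod_eq_of_lt (Finset.mem_range.1 hj)]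
    · intro n hn
      refine if_neg fun hnj => hn ⟨n / D, ?_⟩
      simp only [← hnj, Nat.mod_add_div]
  convert hasSum_sum h1 using 2 with n
  rw [Finset.sum_ite_eq, if_pos (Finset.mem_range.2 (Nat.mod_lt n hD))]

theorem sum_range_periodic_add {D : ℕ} {f : ℕ → ℚ} (hf : Function.Periodic f D) (α : ℕ) :
    ∑ j ∈ Finset.range D, f (j + α) = ∑ j ∈ Finset.range D, f j := by
  induction α with
  | zero => simp
  | succ α ih =>
    rw [← ih]
    have h1 := Finset.sum_range_succ' (fun j => f (j + α)) D
    rw [Finset.sum_range_succ, zero_add, add_comm D α, hf α] at h1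
    simpa [add_assoc, add_comm 1] using (add_right_cancel h1).symm

/-- Binomial expansion of `n ^ k = (D (s + a) - w) ^ k`; the complex power splits over the product
since `D` and `s + a` are nonnegative reals. -/
theorem natCast_pow_div_cpow {n s k D : ℕ} (hD : 0 < D) {w a : ℝ} (ha : 0 < a)
    (hn : (n : ℝ) + w = D * (s + a)) (z : ℂ) :
    (n : ℂ) ^ k / ((n : ℂ) + (w : ℂ)) ^ z = (D : ℂ) ^ (-z) *
      ∑ l ∈ Finset.range (k + 1), (k.choose l : ℂ) * (-(w : ℂ)) ^ l * (D : ℂ) ^ (k - l) *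
        (1 / ((s : ℂ) + (a : ℂ)) ^ (z - k + l)) := by
  have hnC : (n : ℂ) + (w : ℂ) = D * (s + a) := by exact_mod_cast hn
  have hsa : (0 : ℝ) < s + a := by positivity
  have hsaC : (s : ℂ) + (a : ℂ) ≠ 0 := by exact_mod_cast hsa.ne'
  have hDC : (D : ℂ) ≠ 0 := by exact_mod_cast hD.ne'
  have hk : (n : ℂ) ^ k = ∑ l ∈ Finset.range (k + 1),
      (-(w : ℂ)) ^ l * (D * (s + a) : ℂ) ^ (k - l) * (k.choose l : ℂ) := by
    rw [← add_pow, ← hnC]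
    ring
  have hpow : ((n : ℂ) + (w : ℂ)) ^ z = (D : ℂ) ^ z * ((s : ℂ) + (a : ℂ)) ^ z := by
    have := Complex.mul_cpow_ofReal_nonneg (Nat.cast_nonneg D) hsa.le z
    rw [hnC]
    exact_mod_cast this
  rw [hk, hpow, Finset.sum_div, Finset.mul_sum, Complex.cpow_neg]
  refine Finset.sum_congr rfl fun l hl => ?_
  have hl' : l ≤ k := Nat.lt_succ_iff.1 (Finset.mem_range.1 hl)
  have hexp : z - k + l = z - ((k - l : ℕ) : ℂ) := by
    push_cast [Nat.cast_sub hl']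
    ring
  have h1 : (D : ℂ) ^ z ≠ 0 := by simp [Complex.cpow_eq_zero_iff, hDC]
  have h2 : ((s : ℂ) + (a : ℂ)) ^ z ≠ 0 := by simp [Complex.cpow_eq_zero_iff, hsaC]
  rw [hexp, Complex.cpow_sub _ _ hsaC, Complex.cpow_natCast, mul_pow]
  field_simp

/-- The right-hand side of the expression of the zeta function by Hurwitz zeta functions. -/
def zetaContinuation (H : ℕ → ℕ) (D : ℕ) {m : ℕ} (d : Fin m → ℕ → ℚ) (α : ℕ) (w : ℝ) (z : ℂ) : ℂ :=
  theta H α w z +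
    (D : ℂ) ^ (-z) * ∑ k : Fin m, ∑ j ∈ Finset.range D, (d k (j + α) : ℂ) *
      ∑ l ∈ Finset.range ((k : ℕ) + 1),
        ((k : ℕ).choose l : ℂ) * (-(w : ℂ)) ^ l * (D : ℂ) ^ ((k : ℕ) - l) *
          hurwitz (z - (k : ℂ) + (l : ℂ)) (((j : ℝ) + (α : ℝ) + w) / (D : ℝ))

variable {H : ℕ → ℕ} {D m : ℕ} {d : Fin m → ℕ → ℚ} {α : ℕ} {w : ℝ}

theorem hasSum_zetaTerm (hD : 0 < D) (hd : ∀ k, Function.Periodic (d k) D)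
    (hα : ∀ n, α ≤ n → (H n : ℚ) = quasiEval d n) (hw : 0 < w) {z : ℂ} (hz : (m : ℝ) < z.re) :
    HasSum (zetaTerm H w z) (zetaContinuation H D d α w z) := by
  rw [zetaContinuation, add_comm, theta]
  refine (hasSum_nat_add_iff α).1 ?_
  rw [Finset.sum_comm, Finset.mul_sum]
  refine hasSum_of_hasSum_residue hD fun j _ => ?_
  set a : ℝ := ((j : ℝ) + (α : ℝ) + w) / (D : ℝ) with ha
  have hDR : (0 : ℝ) < D := by exact_mod_cast hD
  have ha0 : 0 < a := by positivity
  have hterm : ∀ s : ℕ, zetaTerm H w z (j + D * s + α) = (D : ℂ) ^ (-z) * ∑ k : Fin m,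
      (d k (j + α) : ℂ) * ∑ l ∈ Finset.range ((k : ℕ) + 1),
        ((k : ℕ).choose l : ℂ) * (-(w : ℂ)) ^ l * (D : ℂ) ^ ((k : ℕ) - l) *
          (1 / ((s : ℂ) + (a : ℂ)) ^ (z - (k : ℂ) + (l : ℂ))) := by
    intro s
    have hH : (H (j + D * s + α) : ℂ) =
        ∑ k : Fin m, (d k (j + α) : ℂ) * ((j + D * s + α : ℕ) : ℂ) ^ (k : ℕ) := by
      have h1 := hα (j + D * s + α) (by omega)
      have h2 : (H (j + D * s + α) : ℚ) =
          ∑ k : Fin m, d k (j + α) * ((j + D * s + α : ℕ) : ℚ) ^ (k : ℕ) := by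
        rw [h1, quasiEval]
        refine Finset.sum_congr rfl fun k _ => ?_
        have : d k (j + D * s + α) = d k (j + α) := by
          rw [show j + D * s + α = j + α + s * D by ring]
          exact (hd k).nat_mul s (j + α)
        rw [this]
      exact_mod_cast congrArg (Rat.cast : ℚ → ℂ) h2
    rw [zetaTerm, hH, Finset.sum_div, Finset.mul_sum]
    refine Finset.sum_congr rfl fun k _ => ?_
    rw [mul_div_assoc, natCast_pow_div_cpow hD ha0 (s := s)]
    · ring
    · rw [ha]
      push_cast
      field_simp
      ring
  simp only [hterm]
  refine HasSum.mul_left _ (hasSum_sum fun k _ => HasSum.mul_left _ (hasSum_sum fun l _ =>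
    HasSum.mul_left _ (hasSum_hurwitz ha0 ?_)))
  have hk : ((k : ℕ) : ℝ) + 1 ≤ m := by exact_mod_cast k.2
  have hl : (0 : ℝ) ≤ l := Nat.cast_nonneg l
  -- Since `k ≤ m - 1`, every argument `z - k + l` has real part above `1`.
  simp only [Complex.add_re, Complex.sub_re, Complex.natCast_re]
  linarith

theorem differentiable_theta (hw : 0 < w) : Differentiable ℂ (theta H α w) := by
  unfold theta zetaTerm
  refine Differentiable.fun_sum fun n _ z => ?_
  have hb : (n : ℂ) + (w : ℂ) ≠ 0 := by
    have : (0 : ℝ) < n + w := by positivity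
    exact_mod_cast this.ne'
  exact (differentiableAt_const _).div (analyticAt_const_cpow hb z).differentiableAt
    fun h => hb ((Complex.cpow_eq_zero_iff _ _).1 h).1

theorem analyticAt_cpow_neg (hD : 0 < D) (z : ℂ) : AnalyticAt ℂ (fun z => (D : ℂ) ^ (-z)) z := by
  have hDC : (D : ℂ) ≠ 0 := by exact_mod_cast hD.ne'
  have : Differentiable ℂ fun z : ℂ => (D : ℂ) ^ (-z) := fun z =>
    differentiableAt_id.neg.const_cpow (Or.inl hDC)
  exact this.analyticAt z

theorem analyticAt_zetaContinuation (hD : 0 < D) (hw : 0 < w) {z : ℂ}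
    (hz : ∀ k : Fin m, z ≠ (k : ℂ) + 1) : AnalyticAt ℂ (zetaContinuation H D d α w) z := by
  refine ((differentiable_theta hw).analyticAt z).add ((analyticAt_cpow_neg hD z).mul ?_)
  refine Finset.analyticAt_fun_sum _ fun k _ => Finset.analyticAt_fun_sum _ fun j _ =>
    analyticAt_const.mul (Finset.analyticAt_fun_sum _ fun l hl => analyticAt_const.mul ?_)
  have hDR : (0 : ℝ) < D := by exact_mod_cast hD
  have ha0 : 0 < ((j : ℝ) + (α : ℝ) + w) / (D : ℝ) := by positivity
  have hana : AnalyticAt ℂ (fun z : ℂ => z - (k : ℂ) + (l : ℂ)) z := by fun_prop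
  refine AnalyticAt.fun_comp (g := fun z => hurwitz z _) (analyticAt_hurwitz ha0 fun h => ?_) hana
  have hl' : l ≤ k := Nat.lt_succ_iff.1 (Finset.mem_range.1 hl)
  refine hz ⟨k - l, by omega⟩ ?_
  push_cast [Nat.cast_sub hl']
  linear_combination h

/-- Allowing residue `0` treats the polar and the analytic terms uniformly, so all of them can be
summed at once. -/
theorem hurwitz_shift_hasSimplePole {a : ℝ} (ha : 0 < a) (c : ℂ) (k l : ℕ) :
    HasSimplePoleWithResidue (fun z => hurwitz (z - (k : ℂ) + (l : ℂ)) a) c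
      (if c - k + l = 1 then 1 else 0) := by
  have key : HasSimplePoleWithResidue (fun z => hurwitz z a) (c + ((l : ℂ) - k))
      (if c - k + l = 1 then 1 else 0) := by
    rw [show c + ((l : ℂ) - k) = c - k + l by ring]
    split_ifs with h
    · rw [h]; exact hurwitz_hasSimplePole ha
    · exact .of_analyticAt (analyticAt_hurwitz ha h)
  convert key.comp_add_const using 3 with z
  ring

/-- At `z = k₀ + 1` only the shift `l = k - k₀` meets the Hurwitz pole. The surviving `D ^ k₀` times
`D ^ (-(k₀ + 1))` is the factor `1 / D` of the residue. -/
theorem sum_choose_mul_ite (w D : ℂ) (k k₀ : ℕ) :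
    ∑ l ∈ Finset.range (k + 1), (k.choose l : ℂ) * (-w) ^ l * D ^ (k - l) *
      (if (k₀ : ℂ) + 1 - k + l = 1 then 1 else 0) =
    if k₀ ≤ k then (k.choose k₀ : ℂ) * (-w) ^ (k - k₀) * D ^ k₀ else 0 := by
  have hiff : ∀ l : ℕ, ((k₀ : ℂ) + 1 - k + l = 1) ↔ k₀ + l = k := by
    intro l
    rw [← Nat.cast_inj (R := ℂ)]
    push_cast
    constructor <;> intro h <;> linear_combination h
  simp only [hiff]
  split_ifs with h
  · rw [Finset.sum_eq_single (k - k₀)]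
    · rw [if_pos (by omega), Nat.choose_symm h, Nat.sub_sub_self h, mul_one]
    · intro l _ hl
      rw [if_neg (by omega), mul_zero]
    · intro hl
      exact absurd (Finset.mem_range.2 (by omega)) hl
  · refine Finset.sum_eq_zero fun l _ => ?_
    rw [if_neg (by omega), mul_zero]

theorem zetaContinuation_hasSimplePole (hD : 0 < D) (hd : ∀ k, Function.Periodic (d k) D)
    (hw : 0 < w) (k₀ : Fin m) :
    HasSimplePoleWithResidue (zetaContinuation H D d α w) ((k₀ : ℂ) + 1)
      (1 / (D : ℂ) * ∑ l ∈ Finset.Ici k₀,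
        ((l : ℕ).choose (k₀ : ℕ) : ℂ) * (-(w : ℂ)) ^ ((l : ℕ) - (k₀ : ℕ)) *
          ∑ j ∈ Finset.range D, (d l j : ℂ)) := by
  have hDR : (0 : ℝ) < D := by exact_mod_cast hD
  have hDC : (D : ℂ) ≠ 0 := by exact_mod_cast hD.ne'
  have h := HasSimplePoleWithResidue.add
    (.of_analyticAt ((differentiable_theta (H := H) (α := α) hw).analyticAt ((k₀ : ℂ) + 1)))
    (HasSimplePoleWithResidue.analyticAt_mul (analyticAt_cpow_neg hD ((k₀ : ℂ) + 1))
      (HasSimplePoleWithResidue.sum Finset.univ fun k _ =>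
        HasSimplePoleWithResidue.sum (Finset.range D) fun j _ =>
          HasSimplePoleWithResidue.const_mul (d k (j + α) : ℂ)
            (HasSimplePoleWithResidue.sum (Finset.range ((k : ℕ) + 1)) fun l _ =>
              HasSimplePoleWithResidue.const_mul
                (((k : ℕ).choose l : ℂ) * (-(w : ℂ)) ^ l * (D : ℂ) ^ ((k : ℕ) - l))
                (hurwitz_shift_hasSimplePole (a := ((j : ℝ) + (α : ℝ) + w) / (D : ℝ))
                  (by positivity) ((k₀ : ℂ) + 1) k l))))
  refine (congrArg (HasSimplePoleWithResidue _ _) ?_).mpr h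
  simp only [sum_choose_mul_ite, zero_add]
  have hper : ∀ k, ∑ j ∈ Finset.range D, (d k (j + α) : ℂ) = ∑ j ∈ Finset.range D, (d k j : ℂ) :=
    fun k => by exact_mod_cast congrArg (Rat.cast : ℚ → ℂ) (sum_range_periodic_add (hd k) α)
  simp only [← Finset.sum_mul, hper]
  rw [← Finset.filter_le_eq_Ici, Finset.sum_filter, Finset.mul_sum, Finset.mul_sum]
  refine Finset.sum_congr rfl fun k _ => ?_
  simp only [Fin.le_def]
  split_ifs with hk
  · rw [Complex.cpow_neg, Complex.cpow_add _ _ hDC, Complex.cpow_natCast, Complex.cpow_one]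
    field_simp
  · simp

theorem meromorphicOn_zetaContinuation (hD : 0 < D) (hd : ∀ k, Function.Periodic (d k) D)
    (hw : 0 < w) : MeromorphicOn (zetaContinuation H D d α w) Set.univ := by
  intro z _
  by_cases hz : ∀ k : Fin m, z ≠ (k : ℂ) + 1
  · exact (analyticAt_zetaContinuation hD hw hz).meromorphicAt
  · push Not at hz
    obtain ⟨k, rfl⟩ := hz
    exact (zetaContinuation_hasSimplePole hD hd hw k).meromorphicAt

theorem eq_quasiEval_of_alphaIndex_le (h : IsHilbertQuasiPolynomial H D m d) {n : ℕ}
    (hn : alphaIndex H d ≤ n) : (H n : ℚ) = quasiEval d n :=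
  Nat.sInf_mem (s := {n₀ : ℕ | ∀ n, n₀ ≤ n → (H n : ℚ) = quasiEval d n})
    (eventually_atTop.1 h.eventually_eq) n hn

end Zeta

/-! ### Homogeneous components and finite-dimensionality -/

section HilbertSerre

open Filter DirectSum

theorem finrank_map_add_finrank_inf_ker {K V W : Type*} [Field K] [AddCommGroup V] [Module K V]
    [AddCommGroup W] [Module K W] (L : V →ₗ[K] W) (Y : Submodule K V) [Module.Finite K Y] :
    Module.finrank K (Y.map L) + Module.finrank K (Y ⊓ LinearMap.ker L : Submodule K V) =
      Module.finrank K Y := by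
  rw [← LinearMap.finrank_range_add_finrank_ker (L.domRestrict Y), LinearMap.range_domRestrict,
    LinearMap.ker_domRestrict]
  congr 1
  rw [← Submodule.map_comap_subtype]
  exact LinearEquiv.finrank_eq (Submodule.equivSubtypeMap _ _).symm

variable {K S M : Type*} [Field K] [CommRing S] [Algebra K S]
  [AddCommGroup M] [Module K M] [Module S M]

/-- Projection onto the component of degree `n`. -/
def component (ℳ : ℕ → Submodule K M) [Decomposition ℳ] (n : ℕ) : M →ₗ[K] M :=
  (ℳ n).subtype ∘ₗ DirectSum.component K ℕ (fun i => ℳ i) n ∘ₗ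
    (decomposeLinearEquiv ℳ).toLinearMap

section component

variable (ℳ : ℕ → Submodule K M) [Decomposition ℳ]

theorem component_apply (n : ℕ) (x : M) : component ℳ n x = (decompose ℳ x n : M) := rfl

theorem component_mem (n : ℕ) (x : M) : component ℳ n x ∈ ℳ n := (decompose ℳ x n).2

variable {ℳ}

theorem component_of_mem {n : ℕ} {x : M} (hx : x ∈ ℳ n) : component ℳ n x = x :=
  decompose_of_mem_same ℳ hx

theorem component_of_mem_ne {n k : ℕ} {x : M} (hx : x ∈ ℳ n) (h : n ≠ k) :
    component ℳ k x = 0 :=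
  decompose_of_mem_ne ℳ hx h

theorem component_smul_add {𝒜 : ℕ → Submodule K S} [SetLike.GradedSMul 𝒜 ℳ] {a : ℕ} {s : S}
    (hs : s ∈ 𝒜 a) (n : ℕ) (x : M) : component ℳ (n + a) (s • x) = s • component ℳ n x := by
  induction x using Decomposition.inductionOn ℳ with
  | zero => simp
  | @homogeneous i y =>
    have h1 : s • (y : M) ∈ ℳ (a + i) := SetLike.GradedSMul.smul_mem hs y.2
    by_cases h : i = n
    · subst h
      rw [component_of_mem y.2, add_comm, component_of_mem h1]
    · rw [component_of_mem_ne y.2 h, component_of_mem_ne h1 (by omega), smul_zero]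
  | add x y hx hy => simp only [smul_add, map_add, hx, hy]

theorem component_smul_of_lt {𝒜 : ℕ → Submodule K S} [SetLike.GradedSMul 𝒜 ℳ] {a : ℕ} {s : S}
    (hs : s ∈ 𝒜 a) {k : ℕ} (hk : k < a) (x : M) : component ℳ k (s • x) = 0 := by
  induction x using Decomposition.inductionOn ℳ with
  | zero => simp
  | @homogeneous i y =>
    have h1 : s • (y : M) ∈ ℳ (a + i) := SetLike.GradedSMul.smul_mem hs y.2
    exact component_of_mem_ne h1 (by omega)
  | add x y hx hy => simp only [smul_add, map_add, hx, hy, add_zero]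

variable (ℳ) in
theorem exists_component_eq_zero (x : M) : ∃ B, ∀ n, B ≤ n → component ℳ n x = 0 := by
  induction x using Decomposition.inductionOn ℳ with
  | zero => exact ⟨0, fun n _ => map_zero _⟩
  | @homogeneous i y => exact ⟨i + 1, fun n hn => component_of_mem_ne y.2 (by omega)⟩
  | add x y hx hy =>
    obtain ⟨B, hB⟩ := hx
    obtain ⟨B', hB'⟩ := hy
    exact ⟨max B B', fun n hn => by rw [map_add, hB n (by omega), hB' n (by omega), add_zero]⟩

theorem sum_component_eq {x : M} {B : ℕ} (hB : ∀ n, B ≤ n → component ℳ n x = 0) :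
    ∑ n ∈ Finset.range B, component ℳ n x = x := by
  classical
  conv_rhs => rw [← sum_support_decompose ℳ x]
  refine (Finset.sum_subset (fun n hn => ?_) fun n _ hn => ?_).symm
  · by_contra h
    have h1 := hB n (by simpa using h)
    rw [component_apply] at h1
    exact (DFinsupp.mem_support_iff.1 hn) (Subtype.ext h1)
  · rw [component_apply, DFinsupp.notMem_support_iff.1 hn]
    rfl

variable (ℳ) in
theorem exists_component_eq_zero_of_finset (T : Finset M) :
    ∃ B, ∀ x ∈ T, ∀ n, B ≤ n → component ℳ n x = 0 := by
  choose B hB using exists_component_eq_zero ℳ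
  exact ⟨T.sup B, fun x hx n hn => hB x n ((Finset.le_sup hx).trans hn)⟩

variable (ℳ) in
/-- Every finite set lies in the span of finitely many homogeneous elements. -/
theorem exists_homogeneous_span (T : Finset M) : ∃ G : Finset (M × ℕ),
    (∀ p ∈ G, p.1 ∈ ℳ p.2) ∧ (T : Set M) ⊆ Submodule.span K (Set.range fun p : G => p.1.1) := by
  classical
  obtain ⟨B, hB⟩ := exists_component_eq_zero_of_finset ℳ T
  refine ⟨(T ×ˢ Finset.range B).image fun p => (component ℳ p.2 p.1, p.2), ?_, fun x hx => ?_⟩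
  · intro p hp
    obtain ⟨q, -, rfl⟩ := Finset.mem_image.1 hp
    exact component_mem ℳ _ _
  · rw [SetLike.mem_coe, ← sum_component_eq (hB x hx)]
    refine Submodule.sum_mem _ fun n hn => Submodule.subset_span ?_
    exact ⟨⟨(component ℳ n x, n), Finset.mem_image.2 ⟨(x, n), Finset.mem_product.2 ⟨hx, hn⟩, rfl⟩⟩,
      rfl⟩

theorem component_le_span {ι : Type*} {v : ι → M} {deg : ι → ℕ} (hv : ∀ i, v i ∈ ℳ (deg i))
    (hspan : Submodule.span K (Set.range v) = ⊤) (n : ℕ) :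
    ℳ n ≤ Submodule.span K (v '' {i | deg i = n}) := by
  intro x hx
  rw [← component_of_mem hx]
  have hx' : x ∈ Submodule.span K (Set.range v) := hspan ▸ Submodule.mem_top
  clear hx
  induction hx' using Submodule.span_induction with
  | mem y hy =>
    obtain ⟨i, rfl⟩ := hy
    by_cases h : deg i = n
    · rw [← h, component_of_mem (hv i)]
      exact Submodule.subset_span ⟨i, rfl, rfl⟩
    · rw [component_of_mem_ne (hv i) h]
      exact zero_mem _
  | zero => rw [map_zero]; exact zero_mem _
  | add y z _ _ hy hz => rw [map_add]; exact add_mem hy hz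
  | smul c y _ hy => rw [map_smul]; exact Submodule.smul_mem _ _ hy

end component

section generators

variable [IsScalarTower K S M]

variable {𝒜 : ℕ → Submodule K S} {r : ℕ} {u : Fin r → S} {a : Fin r → ℕ}

theorem prod_pow_mem [SetLike.GradedMonoid 𝒜] (hu : ∀ i, u i ∈ 𝒜 (a i)) (e : Fin r →₀ ℕ) :
    ∏ i, u i ^ e i ∈ 𝒜 (∑ i, e i * a i) :=
  SetLike.prod_mem_graded _ _ _ fun i _ => by
    simpa only [smul_eq_mul] using SetLike.pow_mem_graded (e i) (hu i)

theorem span_monomial_eq_top (hgen : Algebra.adjoin K (Set.range u) = ⊤) :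
    Submodule.span K (Set.range fun e : Fin r →₀ ℕ => ∏ i, u i ^ e i) = ⊤ := by
  refine eq_top_iff.2 fun s _ => ?_
  have hs : s ∈ Algebra.adjoin K (Set.range u) := hgen ▸ Algebra.mem_top
  rw [Algebra.adjoin_range_eq_range_aeval] at hs
  obtain ⟨p, rfl⟩ := hs
  change MvPolynomial.aeval u p ∈ _
  rw [MvPolynomial.aeval_def, MvPolynomial.eval₂_eq']
  refine Submodule.sum_mem _ fun e _ => ?_
  rw [← Algebra.smul_def]
  exact Submodule.smul_mem _ _ (Submodule.subset_span ⟨e, rfl⟩)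

theorem span_monomial_smul_eq_top (hgen : Algebra.adjoin K (Set.range u) = ⊤) {ι : Type*}
    {g : ι → M} (hg : Submodule.span S (Set.range g) = ⊤) :
    Submodule.span K (Set.range fun p : (Fin r →₀ ℕ) × ι => (∏ i, u i ^ p.1 i) • g p.2) = ⊤ := by
  have h := Submodule.span_smul_of_span_eq_top (span_monomial_eq_top hgen) (Set.range g)
  rw [hg, Submodule.restrictScalars_top] at h
  rw [← h]
  congr 1
  ext x
  simp [Set.mem_smul]

variable (ℳ : ℕ → Submodule K M) [Decomposition ℳ] [SetLike.GradedMonoid 𝒜]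
  [SetLike.GradedSMul 𝒜 ℳ]

theorem component_le_span_monomial_smul (hu : ∀ i, u i ∈ 𝒜 (a i))
    (hgen : Algebra.adjoin K (Set.range u) = ⊤) {ι : Type*}
    {g : ι → M} {b : ι → ℕ} (hb : ∀ i, g i ∈ ℳ (b i))
    (hg : Submodule.span S (Set.range g) = ⊤) (n : ℕ) :
    ℳ n ≤ Submodule.span K ((fun p : (Fin r →₀ ℕ) × ι => (∏ i, u i ^ p.1 i) • g p.2) ''
      {p | ∑ i, p.1 i * a i + b p.2 = n}) :=
  component_le_span (deg := fun p : (Fin r →₀ ℕ) × ι => ∑ i, p.1 i * a i + b p.2)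
    (fun p => SetLike.GradedSMul.smul_mem (prod_pow_mem hu p.1) (hb p.2))
    (span_monomial_smul_eq_top hgen hg) n

theorem finite_component [Module.Finite S M] (ha : ∀ i, 0 < a i) (hu : ∀ i, u i ∈ 𝒜 (a i))
    (hgen : Algebra.adjoin K (Set.range u) = ⊤) (n : ℕ) : Module.Finite K (ℳ n) := by
  obtain ⟨T, hT⟩ := (Module.Finite.fg_top : (⊤ : Submodule S M).FG)
  obtain ⟨G, hG, hTG⟩ := exists_homogeneous_span ℳ T
  have hspan : Submodule.span S (Set.range fun p : G => p.1.1) = ⊤ := by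
    rw [eq_top_iff, ← hT, Submodule.span_le]
    exact hTG.trans (Submodule.span_le_restrictScalars K S _)
  have hle := component_le_span_monomial_smul ℳ hu hgen (g := fun p : G => p.1.1)
    (b := fun p => p.1.2) (fun p => hG p.1 p.2) hspan n
  -- Positive generator degrees bound every exponent by `n`, so only finitely many monomials land in
  -- degree `n`.
  have hfin : {p : (Fin r →₀ ℕ) × G | ∑ i, p.1 i * a i + p.2.1.2 = n}.Finite := by
    refine ((Set.finite_Iic (Finsupp.equivFunOnFinite.symm fun _ => n)).prod
      Set.finite_univ).subset fun p hp => ⟨fun i => ?_, Set.mem_univ _⟩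
    have h1 : p.1 i * a i ≤ ∑ i, p.1 i * a i :=
      Finset.single_le_sum (f := fun i => p.1 i * a i) (fun _ _ => Nat.zero_le _)
        (Finset.mem_univ i)
    have h2 := Nat.le_mul_of_pos_right (p.1 i) (ha i)
    have h3 : ∑ i, p.1 i * a i + p.2.1.2 = n := hp
    change p.1 i ≤ n
    omega
  have := FiniteDimensional.span_of_finite K (hfin.image
    fun p : (Fin r →₀ ℕ) × G => (∏ i, u i ^ p.1 i) • p.2.1.1)
  exact Submodule.finiteDimensional_of_le hle

end generators

end HilbertSerre

/-! ### The Hilbert–Serre induction on graded subquotients -/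

section HilbertSerre

open Filter DirectSum

variable {K S M : Type*} [Field K] [CommRing S] [Algebra K S]
  [AddCommGroup M] [Module K M] [Module S M] {ℳ : ℕ → Submodule K M}

/-- The submodule `{x ∈ N | s • x ∈ N'}`. -/
def colonIn (s : S) (N N' : Submodule S M) : Submodule S M :=
  N ⊓ N'.comap (LinearMap.lsmul S M s)

theorem mem_colonIn {s : S} {N N' : Submodule S M} {x : M} :
    x ∈ colonIn s N N' ↔ x ∈ N ∧ s • x ∈ N' := Iff.rfl

/-- The submodule `N' + s N`. -/
def supSMul (s : S) (N N' : Submodule S M) : Submodule S M :=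
  N' ⊔ N.map (LinearMap.lsmul S M s)

theorem mem_supSMul {s : S} {N N' : Submodule S M} {x : M} :
    x ∈ supSMul s N N' ↔ ∃ y ∈ N', ∃ z ∈ N, y + s • z = x := by
  simp [supSMul, Submodule.mem_sup]

variable (ℳ) in
/-- The component of degree `n` of a submodule. -/
def gradedPiece [IsScalarTower K S M] (N : Submodule S M) (n : ℕ) : Submodule K M := N.restrictScalars K ⊓ ℳ n

theorem mem_gradedPiece [IsScalarTower K S M] {N : Submodule S M} {n : ℕ} {x : M} :
    x ∈ gradedPiece ℳ N n ↔ x ∈ N ∧ x ∈ ℳ n := Iff.rfl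

theorem gradedPiece_mono [IsScalarTower K S M] {N N' : Submodule S M} (h : N ≤ N') (n : ℕ) :
    gradedPiece ℳ N n ≤ gradedPiece ℳ N' n := inf_le_inf_right _ h

variable [Decomposition ℳ] {𝒜 : ℕ → Submodule K S} [SetLike.GradedSMul 𝒜 ℳ]

theorem isHomogeneous_colonIn {a : ℕ} {s : S} (hs : s ∈ 𝒜 a) {N N' : Submodule S M}
    (hN : N.IsHomogeneous ℳ) (hN' : N'.IsHomogeneous ℳ) : (colonIn s N N').IsHomogeneous ℳ := by
  intro n x hx
  refine ⟨hN n hx.1, ?_⟩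
  change s • component ℳ n x ∈ N'
  rw [← component_smul_add hs]
  exact hN' (n + a) hx.2

theorem isHomogeneous_supSMul {a : ℕ} {s : S} (hs : s ∈ 𝒜 a) {N N' : Submodule S M}
    (hN : N.IsHomogeneous ℳ) (hN' : N'.IsHomogeneous ℳ) : (supSMul s N N').IsHomogeneous ℳ := by
  intro n x hx
  obtain ⟨y, hy, z, hz, rfl⟩ := mem_supSMul.1 hx
  change component ℳ n (y + s • z) ∈ supSMul s N N'
  rw [map_add]
  refine mem_supSMul.2 ⟨_, hN' n hy, ?_⟩
  rcases lt_or_ge n a with h | h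
  · exact ⟨0, zero_mem _, by rw [component_smul_of_lt hs h, smul_zero]; rfl⟩
  · obtain ⟨k, rfl⟩ := Nat.exists_eq_add_of_le' h
    exact ⟨_, hN k hz, by rw [component_smul_add hs]; rfl⟩

variable [IsScalarTower K S M]

/-- Multiplication by `s` of degree `a` gives an exact sequence
`0 → (C / N')_n → (N / N')_n → (N / N')_{n + a} → (N / (N' + s N))_{n + a} → 0`. -/
theorem finrank_gradedPiece_colonIn [∀ n, Module.Finite K (ℳ n)] {a : ℕ} {s : S} (hs : s ∈ 𝒜 a)
    {N N' : Submodule S M} (hN : N.IsHomogeneous ℳ) (hN' : N'.IsHomogeneous ℳ) (n : ℕ) :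
    Module.finrank K (gradedPiece ℳ N n) + Module.finrank K (gradedPiece ℳ N' (n + a)) =
      Module.finrank K (gradedPiece ℳ (colonIn s N N') n) +
        Module.finrank K (gradedPiece ℳ (supSMul s N N') (n + a)) := by
  have hfin (P : Submodule S M) (k : ℕ) : Module.Finite K (gradedPiece ℳ P k) :=
    Submodule.finiteDimensional_of_le (inf_le_right : gradedPiece ℳ P k ≤ ℳ k)
  set q : M →ₗ[K] M ⧸ N'.restrictScalars K := (N'.restrictScalars K).mkQ with hq
  set L : M →ₗ[K] M ⧸ N'.restrictScalars K :=
    q ∘ₗ ((LinearMap.lsmul S M s).restrictScalars K) with hL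
  have hLx : ∀ x, L x = q (s • x) := fun x => rfl
  have hker : ∀ x, q x = 0 ↔ x ∈ N' := fun x => Submodule.Quotient.mk_eq_zero _
  have h1 := finrank_map_add_finrank_inf_ker L (gradedPiece ℳ N n)
  have h2 := finrank_map_add_finrank_inf_ker q (gradedPiece ℳ (supSMul s N N') (n + a))
  have e1 : gradedPiece ℳ N n ⊓ LinearMap.ker L = gradedPiece ℳ (colonIn s N N') n := by
    ext x
    simp only [Submodule.mem_inf, mem_gradedPiece, LinearMap.mem_ker, hLx, hker, mem_colonIn]
    tauto
  have e2 : gradedPiece ℳ (supSMul s N N') (n + a) ⊓ LinearMap.ker q =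
      gradedPiece ℳ N' (n + a) := by
    ext x
    simp only [Submodule.mem_inf, mem_gradedPiece, LinearMap.mem_ker, hker, mem_supSMul]
    refine ⟨fun h => ⟨h.2, h.1.2⟩, fun h => ⟨⟨⟨x, h.1, 0, zero_mem _, by simp⟩, h.2⟩, h.1⟩⟩
  have e3 : (gradedPiece ℳ N n).map L = (gradedPiece ℳ (supSMul s N N') (n + a)).map q := by
    ext y
    simp only [Submodule.mem_map, mem_gradedPiece, mem_supSMul]
    constructor
    · rintro ⟨x, ⟨hxN, hx⟩, rfl⟩
      refine ⟨s • x, ⟨⟨0, zero_mem _, x, hxN, zero_add _⟩, ?_⟩, rfl⟩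
      rw [add_comm]
      exact SetLike.GradedSMul.smul_mem hs hx
    · rintro ⟨_, ⟨⟨y, hy, z, hz, rfl⟩, hyz⟩, rfl⟩
      -- Only `y + s • z` is known to be homogeneous; its component of degree `n + a` is `s` times
      -- the degree `n` part of `z`, up to an element of `N'`.
      refine ⟨component ℳ n z, ⟨hN n hz, component_mem ℳ n z⟩, ?_⟩
      rw [← component_of_mem hyz, map_add, component_smul_add hs, hLx, map_add,
        (hker (component ℳ (n + a) y)).2 (hN' (n + a) hy), zero_add]
  rw [e1, e3] at h1
  rw [e2] at h2
  omega

/-- If all generators kill `N / N'`, then every `s` acts on it through a scalar. The finite set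
generating `N` over `S` thus spans `N / N'` over `K`, and its components vanish in high degree. -/
theorem eventually_gradedPiece_eq [Module.Finite S M] [IsNoetherianRing S] {r : ℕ} {u : Fin r → S}
    (hgen : Algebra.adjoin K (Set.range u) = ⊤) {N N' : Submodule S M}
    (hN' : N'.IsHomogeneous ℳ) (hle : N' ≤ N) (hu : ∀ i, ∀ x ∈ N, u i • x ∈ N') :
    ∀ᶠ n in atTop, gradedPiece ℳ N n = gradedPiece ℳ N' n := by
  have hscalar : ∀ s : S, ∃ c : K, ∀ x ∈ N, s • x - c • x ∈ N' := by
    intro s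
    have hs : s ∈ Algebra.adjoin K (Set.range u) := hgen ▸ Algebra.mem_top
    induction hs using Algebra.adjoin_induction with
    | mem s hs =>
      obtain ⟨i, rfl⟩ := hs
      exact ⟨0, fun x hx => by simpa using hu i x hx⟩
    | algebraMap c => exact ⟨c, fun x _ => by simp⟩
    | add s t _ _ hs ht =>
      obtain ⟨c, hc⟩ := hs
      obtain ⟨e, he⟩ := ht
      refine ⟨c + e, fun x hx => ?_⟩
      have := add_mem (hc x hx) (he x hx)
      rw [add_smul, add_smul]
      convert this using 1
      abel
    | mul s t _ _ hs ht =>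
      obtain ⟨c, hc⟩ := hs
      obtain ⟨e, he⟩ := ht
      refine ⟨c * e, fun x hx => ?_⟩
      have h1 := hc (t • x) (N.smul_mem t hx)
      have h2 := (N'.restrictScalars K).smul_mem c (he x hx)
      have := add_mem h1 h2
      rw [mul_smul, mul_smul]
      convert this using 1
      rw [smul_sub]
      abel
  have := isNoetherian_of_isNoetherianRing_of_finite S M
  obtain ⟨T, hT⟩ := IsNoetherian.noetherian N
  obtain ⟨B, hB⟩ := exists_component_eq_zero_of_finset ℳ T
  have hmod : ∀ x ∈ N, ∃ y ∈ N', x - y ∈ Submodule.span K (T : Set M) := by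
    intro x hx
    rw [← hT] at hx
    induction hx using Submodule.span_induction with
    | mem x hx => exact ⟨0, zero_mem _, by simpa using Submodule.subset_span hx⟩
    | zero => exact ⟨0, zero_mem _, by simp⟩
    | add x x' _ _ hx hx' =>
      obtain ⟨y, hy, h⟩ := hx
      obtain ⟨y', hy', h'⟩ := hx'
      refine ⟨y + y', add_mem hy hy', ?_⟩
      rw [add_sub_add_comm]
      exact add_mem h h'
    | smul s x hxT hx =>
      obtain ⟨y, hy, h⟩ := hx
      obtain ⟨c, hc⟩ := hscalar s
      have hxN : x ∈ N := hT ▸ hxT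
      refine ⟨(s • x - c • x) + c • y, add_mem (hc x hxN)
        ((N'.restrictScalars K).smul_mem c hy), ?_⟩
      convert Submodule.smul_mem _ c h using 1
      rw [smul_sub]
      abel
  refine eventually_atTop.2 ⟨B, fun n hn => le_antisymm (fun x hx => ?_) (gradedPiece_mono hle n)⟩
  obtain ⟨y, hy, hxy⟩ := hmod x hx.1
  refine ⟨?_, hx.2⟩
  have h0 : component ℳ n (x - y) = 0 := by
    have : Submodule.span K (T : Set M) ≤ LinearMap.ker (component ℳ n) :=
      Submodule.span_le.2 fun z hz => hB z hz n hn
    exact this hxy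
  rw [map_sub, component_of_mem hx.2, sub_eq_zero] at h0
  rw [h0]
  exact hN' n hy

/-- `T` lists the generators that may still act nontrivially on `N / N'`. Kernel and cokernel of `u
t` are killed by `u t` too, so `t` leaves the list, at the cost of one difference of step `a t`,
hence of one of step `D`. -/
theorem eventually_fwdDiff_iter_finrank_sub [∀ n, Module.Finite K (ℳ n)] [Module.Finite S M]
    [IsNoetherianRing S] {r : ℕ} {u : Fin r → S} {a : Fin r → ℕ} (hu : ∀ i, u i ∈ 𝒜 (a i))
    (hgen : Algebra.adjoin K (Set.range u) = ⊤) {D : ℕ} (hD : ∀ i, a i ∣ D) (T : Finset (Fin r)) :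
    ∀ {N N' : Submodule S M}, N.IsHomogeneous ℳ → N'.IsHomogeneous ℳ → N' ≤ N →
      (∀ i, i ∉ T → ∀ x ∈ N, u i • x ∈ N') →
      ∀ᶠ n in atTop, (fwdDiff D)^[T.card] (fun n => (Module.finrank K (gradedPiece ℳ N n) : ℚ) -
        Module.finrank K (gradedPiece ℳ N' n)) n = 0 := by
  induction T using Finset.induction_on with
  | empty =>
    intro N N' _ hN' hle hkill
    filter_upwards [eventually_gradedPiece_eq hgen hN' hle fun i => hkill i (Finset.notMem_empty i)]
      with n hn
    simp only [Finset.card_empty, Function.iterate_zero, id_eq]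
    rw [hn, sub_self]
  | insert t T ht ih =>
    intro N N' hN hN' hle hkill
    rw [Finset.card_insert_of_notMem ht]
    refine eventually_fwdDiff_iter_succ_eq_zero (hD t) ?_
    have h1 := ih (N := N) (N' := supSMul (u t) N N') hN (isHomogeneous_supSMul (hu t) hN hN')
      (fun x hx => by
        obtain ⟨y, hy, z, hz, rfl⟩ := mem_supSMul.1 hx
        exact add_mem (hle hy) (N.smul_mem _ hz))
      (fun i hi x hx => by
        rcases eq_or_ne i t with rfl | hit
        · exact mem_supSMul.2 ⟨0, zero_mem _, x, hx, zero_add _⟩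
        · exact mem_supSMul.2 ⟨_, hkill i (by simp [hi, hit]) x hx, 0, zero_mem _, by simp⟩)
    have h2 := ih (N := colonIn (u t) N N') (N' := N') (isHomogeneous_colonIn (hu t) hN hN') hN'
      (fun x hx => ⟨hle hx, N'.smul_mem _ hx⟩)
      (fun i hi x hx => by
        rcases eq_or_ne i t with rfl | hit
        · exact hx.2
        · exact hkill i (by simp [hi, hit]) x hx.1)
    set g₁ : ℕ → ℚ := fun n => (Module.finrank K (gradedPiece ℳ N n) : ℚ) -
      Module.finrank K (gradedPiece ℳ (supSMul (u t) N N') n)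
    set g₂ : ℕ → ℚ := fun n => (Module.finrank K (gradedPiece ℳ (colonIn (u t) N N') n) : ℚ) -
      Module.finrank K (gradedPiece ℳ N' n)
    have key : fwdDiff (a t) (fun n => (Module.finrank K (gradedPiece ℳ N n) : ℚ) -
        Module.finrank K (gradedPiece ℳ N' n)) = (fun n => g₁ (n + a t)) + (-1 : ℚ) • g₂ := by
      ext n
      have h : (Module.finrank K (gradedPiece ℳ N n) : ℚ) +
          Module.finrank K (gradedPiece ℳ N' (n + a t)) =
          Module.finrank K (gradedPiece ℳ (colonIn (u t) N N') n) +
          Module.finrank K (gradedPiece ℳ (supSMul (u t) N N') (n + a t)) := by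
        exact_mod_cast finrank_gradedPiece_colonIn (hu t) hN hN' n
      simp only [fwdDiff, g₁, g₂, Pi.add_apply, Pi.smul_apply, smul_eq_mul]
      linear_combination -h
    filter_upwards [(tendsto_add_atTop_nat (a t)).eventually h1, h2] with n hn1 hn2
    rw [key, fwdDiff_iter_add, fwdDiff_iter_const_smul, Pi.add_apply, Pi.smul_apply, hn2,
      fwdDiff_iter_comp_add, hn1, smul_zero, add_zero]

/-- **Hilbert–Serre**: the Hilbert function is annihilated by a power of `E ^ D - 1`, where `E` is
the shift, from some point on. -/
theorem eventually_fwdDiff_iter_hilbertFunction [∀ n, Module.Finite K (ℳ n)] [Module.Finite S M]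
    [IsNoetherianRing S] {r : ℕ} {u : Fin r → S} {a : Fin r → ℕ} (hu : ∀ i, u i ∈ 𝒜 (a i))
    (hgen : Algebra.adjoin K (Set.range u) = ⊤) {D : ℕ} (hD : ∀ i, a i ∣ D) :
    ∀ᶠ n in atTop, (fwdDiff D)^[r] (fun n => (hilbertFunction ℳ n : ℚ)) n = 0 := by
  have h := eventually_fwdDiff_iter_finrank_sub hu hgen hD Finset.univ (N := (⊤ : Submodule S M))
    (N' := ⊥) (fun _ _ _ => Submodule.mem_top)
    (fun n x hx => by
      rw [(Submodule.mem_bot S).1 hx]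
      change component ℳ n 0 ∈ _
      rw [map_zero]
      exact zero_mem _)
    bot_le (fun i hi => absurd (Finset.mem_univ i) hi)
  have htop : ∀ n, gradedPiece ℳ (⊤ : Submodule S M) n = ℳ n := fun n => by simp [gradedPiece]
  have hbot : ∀ n, gradedPiece ℳ (⊥ : Submodule S M) n = ⊥ := fun n => by simp [gradedPiece]
  have key : (fun n => (Module.finrank K (gradedPiece ℳ (⊤ : Submodule S M) n) : ℚ) -
      Module.finrank K (gradedPiece ℳ (⊥ : Submodule S M) n)) =
      fun n => (hilbertFunction ℳ n : ℚ) := by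
    ext n
    rw [htop, hbot, finrank_bot, hilbertFunction, Nat.cast_zero, sub_zero]
  rwa [key, Finset.card_univ, Fintype.card_fin] at h

end HilbertSerre

/-! ### Growth of the partial sums: comparison of two filtrations -/

section Growth

open DirectSum

theorem finrank_restrictDegree (K : Type*) [Field K] (m N : ℕ) :
    Module.finrank K (MvPolynomial.restrictDegree (Fin m) K N) = (N + 1) ^ m := by
  let e : {n : Fin m →₀ ℕ | ∀ i, n i ≤ N} ≃ (Fin m → Fin (N + 1)) :=
    { toFun := fun n i => ⟨n.1 i, Nat.lt_succ_of_le (n.2 i)⟩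
      invFun := fun f => ⟨Finsupp.equivFunOnFinite.symm fun i => (f i : ℕ),
        fun i => Nat.le_of_lt_succ (f i).2⟩
      left_inv := fun n => by ext; rfl
      right_inv := fun f => by ext; rfl }
  have h := Module.finrank_eq_nat_card_basis
    (MvPolynomial.basisRestrictSupport K {n : Fin m →₀ ℕ | ∀ i, n i ≤ N})
  rw [Nat.card_congr e] at h
  rw [MvPolynomial.restrictDegree, h]
  simp

/-- Infinite dimension would make `finrank` zero, whereas it is `(N + 1) ^ m`. -/
theorem finite_restrictDegree (K : Type*) [Field K] (m N : ℕ) :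
    Module.Finite K (MvPolynomial.restrictDegree (Fin m) K N) :=
  Module.finite_of_finrank_pos (by rw [finrank_restrictDegree]; positivity)

theorem mul_mem_restrictDegree {K σ : Type*} [Field K] {p q : MvPolynomial σ K} {N N' : ℕ}
    (hp : p ∈ MvPolynomial.restrictDegree σ K N) (hq : q ∈ MvPolynomial.restrictDegree σ K N') :
    p * q ∈ MvPolynomial.restrictDegree σ K (N + N') := by
  have h := Submodule.mul_mem_mul hp hq
  rw [MvPolynomial.restrictDegree, MvPolynomial.restrictDegree,
    ← MvPolynomial.restrictSupport_add] at h
  refine MvPolynomial.restrictSupport_mono K ?_ h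
  rintro _ ⟨e, he, e', he', rfl⟩ i
  exact add_le_add (he i) (he' i)

theorem restrictDegree_mono {K σ : Type*} [Field K] {N N' : ℕ} (h : N ≤ N') :
    MvPolynomial.restrictDegree σ K N ≤ MvPolynomial.restrictDegree σ K N' :=
  MvPolynomial.restrictSupport_mono K fun _ he i => (he i).trans h

theorem exists_mem_restrictDegree {K σ : Type*} [Field K] (p : MvPolynomial σ K) :
    ∃ N, p ∈ MvPolynomial.restrictDegree σ K N := by
  refine ⟨p.totalDegree, (MvPolynomial.mem_restrictDegree _ _ _).2 fun s hs i => ?_⟩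
  exact (Finsupp.le_degree i s).trans (MvPolynomial.le_totalDegree hs)

variable {K S M : Type*} [Field K] [CommRing S]
  [AddCommGroup M] [Module K M] [Module S M]

/-- Used for both filtrations: each factor costs a shift `c`, a monomial costs `c` times its total
exponent. -/
theorem prod_pow_smul_mem {ι : Type*} {s : ι → S} {F : ℕ → Submodule K M} {c : ℕ}
    (hs : ∀ i B, ∀ x ∈ F B, s i • x ∈ F (B + c)) (I : Finset ι) (e : ι → ℕ) {B : ℕ} {x : M}
    (hx : x ∈ F B) : (∏ i ∈ I, s i ^ e i) • x ∈ F (B + c * ∑ i ∈ I, e i) := by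
  have hpow : ∀ i k B, ∀ x ∈ F B, s i ^ k • x ∈ F (B + c * k) := by
    intro i k
    induction k with
    | zero => intro B x hx; simpa using hx
    | succ k ih =>
      intro B x hx
      rw [pow_succ', mul_smul, mul_add_one, ← add_assoc]
      exact hs i _ _ (ih B x hx)
  classical
  induction I using Finset.induction_on with
  | empty => simpa using hx
  | insert i I hi ih =>
    rw [Finset.prod_insert hi, Finset.sum_insert hi, mul_smul, mul_add, add_comm (c * e i),
      ← add_assoc]
    exact hpow i _ _ _ ih

/-- Uniformity over finitely many elements of a shift of filtration. -/
theorem exists_uniform_shift {r : ℕ} {u : Fin r → S} {F : ℕ → Submodule K M} (hF : Monotone F)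
    (h : ∀ s : S, ∃ c, ∀ B, ∀ x ∈ F B, s • x ∈ F (B + c)) :
    ∃ c, ∀ i B, ∀ x ∈ F B, u i • x ∈ F (B + c) := by
  choose c hc using fun i => h (u i)
  exact ⟨Finset.univ.sup c, fun i B x hx =>
    hF (Nat.add_le_add_left (Finset.le_sup (Finset.mem_univ i)) B) (hc i B x hx)⟩

variable [Algebra K S]

/-! ### The filtration by degree -/

section degreeLT

variable (ℳ : ℕ → Submodule K M) [Decomposition ℳ]

/-- The elements all of whose components of degree at least `B` vanish. -/
def degreeLT (B : ℕ) : Submodule K M := ⨅ n, ⨅ _ : B ≤ n, LinearMap.ker (component ℳ n)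

variable {ℳ}

theorem mem_degreeLT {B : ℕ} {x : M} :
    x ∈ degreeLT ℳ B ↔ ∀ n, B ≤ n → component ℳ n x = 0 := by
  simp [degreeLT]

theorem degreeLT_mono : Monotone (degreeLT ℳ) := fun _ _ h _ hx =>
  mem_degreeLT.2 fun n hn => mem_degreeLT.1 hx n (h.trans hn)

variable (ℳ) in
/-- An element of degree less than `B` amounts to its components of degree less than `B`. -/
def degreeLTEquiv (B : ℕ) : degreeLT ℳ B ≃ₗ[K] ((n : Fin B) → ℳ n) where
  toFun x n := ⟨component ℳ n x, component_mem ℳ n x⟩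
  map_add' x y := by ext; simp
  map_smul' c x := by ext; simp
  invFun y := ⟨∑ n : Fin B, (y n : M), mem_degreeLT.2 fun k hk => by
    rw [map_sum]
    exact Finset.sum_eq_zero fun n _ => component_of_mem_ne (y n).2 (by omega)⟩
  left_inv x := by
    ext
    rw [← sum_component_eq (mem_degreeLT.1 x.2), Finset.sum_range]
  right_inv y := by
    ext k
    change component ℳ k (∑ n : Fin B, (y n : M)) = y k
    rw [map_sum, Finset.sum_eq_single k, component_of_mem (y k).2]
    · intro n _ hn
      exact component_of_mem_ne (y n).2 (by simpa [Fin.ext_iff] using hn)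
    · simp

variable (ℳ) in
theorem finrank_degreeLT [∀ n, Module.Finite K (ℳ n)] (B : ℕ) :
    Module.finrank K (degreeLT ℳ B) = ∑ n ∈ Finset.range B, hilbertFunction ℳ n := by
  rw [(degreeLTEquiv ℳ B).finrank_eq, Module.finrank_pi_fintype, Finset.sum_range]
  rfl

variable (ℳ) in
theorem finite_degreeLT [∀ n, Module.Finite K (ℳ n)] (B : ℕ) : Module.Finite K (degreeLT ℳ B) :=
  Module.Finite.equiv (degreeLTEquiv ℳ B).symm

variable [IsScalarTower K S M] {𝒜 : ℕ → Submodule K S} [SetLike.GradedSMul 𝒜 ℳ]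

theorem exists_smul_mem_degreeLT {r : ℕ} {u : Fin r → S} {a : Fin r → ℕ} (hu : ∀ i, u i ∈ 𝒜 (a i))
    (hgen : Algebra.adjoin K (Set.range u) = ⊤) (s : S) :
    ∃ c, ∀ B, ∀ x ∈ degreeLT ℳ B, s • x ∈ degreeLT ℳ (B + c) := by
  have hs : s ∈ Algebra.adjoin K (Set.range u) := hgen ▸ Algebra.mem_top
  induction hs using Algebra.adjoin_induction with
  | mem s hs =>
    obtain ⟨i, rfl⟩ := hs
    refine ⟨a i, fun B x hx => mem_degreeLT.2 fun n hn => ?_⟩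
    obtain ⟨k, rfl⟩ := Nat.exists_eq_add_of_le' (le_of_add_le_right hn)
    rw [component_smul_add (hu i), mem_degreeLT.1 hx k (by omega), smul_zero]
  | algebraMap t =>
    refine ⟨0, fun B x hx => ?_⟩
    rw [algebraMap_smul]
    exact Submodule.smul_mem _ _ hx
  | add s t _ _ hs ht =>
    obtain ⟨c, hc⟩ := hs
    obtain ⟨c', hc'⟩ := ht
    refine ⟨max c c', fun B x hx => ?_⟩
    rw [add_smul]
    exact add_mem (degreeLT_mono (by omega) (hc B x hx)) (degreeLT_mono (by omega) (hc' B x hx))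
  | mul s t _ _ hs ht =>
    obtain ⟨c, hc⟩ := hs
    obtain ⟨c', hc'⟩ := ht
    refine ⟨c' + c, fun B x hx => ?_⟩
    rw [mul_smul, ← add_assoc]
    exact hc _ _ (hc' B x hx)

end degreeLT

/-! ### The filtration by degree of polynomial coefficients -/

section polySpan

variable [IsScalarTower K S M] {m : ℕ} (ψ : MvPolynomial (Fin m) K →ₐ[K] S)
  {ι : Type*} [Fintype ι] (g : ι → M)

/-- The linear combinations of the `g l` with coefficients the values at `ψ` of polynomials of degree
at most `N` in each variable. -/
def polySpan (N : ℕ) : Submodule K M :=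
  LinearMap.range (∑ l : ι, ((LinearMap.toSpanSingleton S M (g l)).restrictScalars K ∘ₗ
    ψ.toLinearMap ∘ₗ (MvPolynomial.restrictDegree (Fin m) K N).subtype ∘ₗ LinearMap.proj l :
      (ι → MvPolynomial.restrictDegree (Fin m) K N) →ₗ[K] M))

variable {ψ g}

theorem mem_polySpan {N : ℕ} {x : M} : x ∈ polySpan ψ g N ↔
    ∃ c : ι → MvPolynomial (Fin m) K, (∀ l, c l ∈ MvPolynomial.restrictDegree (Fin m) K N) ∧
      ∑ l, ψ (c l) • g l = x := by
  simp only [polySpan, LinearMap.mem_range, LinearMap.sum_apply]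
  constructor
  · rintro ⟨c, rfl⟩
    exact ⟨fun l => (c l).1, fun l => (c l).2, rfl⟩
  · rintro ⟨c, hc, rfl⟩
    exact ⟨fun l => ⟨c l, hc l⟩, rfl⟩

theorem polySpan_mono : Monotone (polySpan ψ g) := fun _ _ h _ hx => by
  obtain ⟨c, hc, rfl⟩ := mem_polySpan.1 hx
  exact mem_polySpan.2 ⟨c, fun l => restrictDegree_mono h (hc l), rfl⟩

theorem smul_mem_polySpan {N N' : ℕ} {p : MvPolynomial (Fin m) K}
    (hp : p ∈ MvPolynomial.restrictDegree (Fin m) K N) {x : M} (hx : x ∈ polySpan ψ g N') :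
    ψ p • x ∈ polySpan ψ g (N' + N) := by
  obtain ⟨c, hc, rfl⟩ := mem_polySpan.1 hx
  refine mem_polySpan.2 ⟨fun l => p * c l, fun l => add_comm N N' ▸ mul_mem_restrictDegree hp (hc l),
    ?_⟩
  simp only [map_mul, Finset.smul_sum, mul_smul]

theorem self_mem_polySpan (l : ι) : g l ∈ polySpan ψ g 0 := by
  classical
  refine mem_polySpan.2 ⟨Pi.single l 1, fun k => ?_, ?_⟩
  · rcases eq_or_ne k l with rfl | h
    · rw [Pi.single_eq_same]
      exact (MvPolynomial.monomial_mem_restrictSupport K).2 (Or.inl fun i => Nat.zero_le _)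
    · rw [Pi.single_eq_of_ne h]
      exact zero_mem _
  · rw [Finset.sum_eq_single l]
    · simp
    · intro k _ hk
      simp [Pi.single_eq_of_ne hk]
    · simp

theorem finrank_polySpan_le (N : ℕ) :
    Module.finrank K (polySpan ψ g N) ≤ Fintype.card ι * (N + 1) ^ m := by
  have := finite_restrictDegree K m N
  refine (LinearMap.finrank_range_le _).trans ?_
  rw [Module.finrank_pi_fintype, finrank_restrictDegree]
  simp

theorem finite_polySpan (N : ℕ) : Module.Finite K (polySpan ψ g N) := by
  have := finite_restrictDegree K m N
  exact LinearMap.finiteDimensional_range _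

theorem exists_mem_polySpan (hg : ∀ x, ∃ c : ι → MvPolynomial (Fin m) K, ∑ l, ψ (c l) • g l = x)
    (x : M) : ∃ N, x ∈ polySpan ψ g N := by
  obtain ⟨c, rfl⟩ := hg x
  choose N hN using fun l => exists_mem_restrictDegree (c l)
  exact ⟨Finset.univ.sup N, mem_polySpan.2 ⟨c, fun l =>
    restrictDegree_mono (Finset.le_sup (Finset.mem_univ l)) (hN l), rfl⟩⟩

/-- By commutativity `s` passes to the finitely many `g l`; the shift is what the elements `s • g l`
require. -/
theorem exists_smul_mem_polySpan
    (hg : ∀ x, ∃ c : ι → MvPolynomial (Fin m) K, ∑ l, ψ (c l) • g l = x) (s : S) :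
    ∃ c, ∀ N, ∀ x ∈ polySpan ψ g N, s • x ∈ polySpan ψ g (N + c) := by
  choose B hB using fun l => exists_mem_polySpan hg (s • g l)
  refine ⟨Finset.univ.sup B, fun N x hx => ?_⟩
  obtain ⟨c, hc, rfl⟩ := mem_polySpan.1 hx
  rw [Finset.smul_sum]
  refine Submodule.sum_mem _ fun l _ => ?_
  rw [smul_comm, add_comm N]
  exact smul_mem_polySpan (hc l) (polySpan_mono (Finset.le_sup (Finset.mem_univ l)) (hB l))

end polySpan

variable [IsScalarTower K S M] {ℳ : ℕ → Submodule K M} [Decomposition ℳ]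
  {𝒜 : ℕ → Submodule K S} [SetLike.GradedSMul 𝒜 ℳ]
  {r m : ℕ} {u : Fin r → S} {a : Fin r → ℕ} {ψ : MvPolynomial (Fin m) K →ₐ[K] S}
  {ι : Type*} [Fintype ι] {g : ι → M} {b : ι → ℕ}

/-- A monomial `u ^ e • g l` of degree `n` has total exponent at most `n`, because all `a i ≥ 1`;
hence degree at most `N` lies in `polySpan ψ g (c * N)`, of dimension `O(N ^ m)`. -/
theorem exists_sum_hilbertFunction_le [∀ n, Module.Finite K (ℳ n)] [SetLike.GradedMonoid 𝒜]
    (ha : ∀ i, 0 < a i) (hu : ∀ i, u i ∈ 𝒜 (a i)) (hgen : Algebra.adjoin K (Set.range u) = ⊤)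
    (hb : ∀ l, g l ∈ ℳ (b l))
    (hg : ∀ x, ∃ c : ι → MvPolynomial (Fin m) K, ∑ l, ψ (c l) • g l = x) :
    ∃ B : ℕ, ∀ N, ∑ n ∈ Finset.range (N + 1), hilbertFunction ℳ n ≤ B * (N + 1) ^ m := by
  obtain ⟨c, hc⟩ := exists_uniform_shift (u := u) polySpan_mono (exists_smul_mem_polySpan hg)
  have hspan : Submodule.span S (Set.range g) = ⊤ := by
    refine eq_top_iff.2 fun x _ => ?_
    obtain ⟨e, rfl⟩ := hg x
    exact Submodule.sum_mem _ fun l _ =>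
      Submodule.smul_mem _ _ (Submodule.subset_span ⟨l, rfl⟩)
  have hle : ∀ n, ℳ n ≤ polySpan ψ g (c * n) := by
    intro n
    refine (component_le_span_monomial_smul ℳ hu hgen hb hspan n).trans (Submodule.span_le.2 ?_)
    rintro _ ⟨p, hp, rfl⟩
    have h1 := prod_pow_smul_mem hc Finset.univ p.1 (self_mem_polySpan (ψ := ψ) (g := g) p.2)
    refine polySpan_mono ?_ h1
    have h2 : ∑ i, p.1 i ≤ ∑ i, p.1 i * a i :=
      Finset.sum_le_sum fun i _ => Nat.le_mul_of_pos_right _ (ha i)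
    have h3 : ∑ i, p.1 i * a i + b p.2 = n := hp
    rw [zero_add]
    exact Nat.mul_le_mul_left c (by omega)
  refine ⟨Fintype.card ι * (c + 1) ^ m, fun N => ?_⟩
  have := finite_polySpan (ψ := ψ) (g := g) (c * N)
  rw [← finrank_degreeLT]
  have hsub : degreeLT ℳ (N + 1) ≤ polySpan ψ g (c * N) := by
    intro x hx
    rw [← sum_component_eq (mem_degreeLT.1 hx)]
    refine Submodule.sum_mem _ fun n hn => polySpan_mono ?_ (hle n (component_mem ℳ n x))
    exact Nat.mul_le_mul_left c (Nat.lt_succ_iff.1 (Finset.mem_range.1 hn))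
  refine (Submodule.finrank_mono hsub).trans ((finrank_polySpan_le _).trans ?_)
  rw [mul_assoc, ← mul_pow]
  gcongr
  nlinarith

/-- By faithfulness `p ↦ (ψ p • g l)_l` is injective. It maps the `(N + 1) ^ m`-dimensional space of
polynomials into finitely many copies of a step of the degree filtration that is linear in `N`. -/
theorem exists_le_sum_hilbertFunction [∀ n, Module.Finite K (ℳ n)]
    (hu : ∀ i, u i ∈ 𝒜 (a i)) (hgen : Algebra.adjoin K (Set.range u) = ⊤)
    (hg : ∀ x, ∃ c : ι → MvPolynomial (Fin m) K, ∑ l, ψ (c l) • g l = x)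
    (hψ : ∀ p, (∀ x : M, ψ p • x = 0) → p = 0) :
    ∃ B c b : ℕ, ∀ N, (N + 1) ^ m ≤
      B * ∑ n ∈ Finset.range (c * N + b + 1), hilbertFunction ℳ n := by
  classical
  obtain ⟨c, hc⟩ := exists_uniform_shift (u := fun i => ψ (MvPolynomial.X i)) degreeLT_mono
    (exists_smul_mem_degreeLT (ℳ := ℳ) hu hgen)
  obtain ⟨β, hβ⟩ := exists_component_eq_zero_of_finset ℳ (Finset.univ.image g)
  have hmem : ∀ N, ∀ p ∈ MvPolynomial.restrictDegree (Fin m) K N, ∀ l,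
      ψ p • g l ∈ degreeLT ℳ (c * m * N + β + 1) := by
    intro N p hp l
    have hgl : g l ∈ degreeLT ℳ β := mem_degreeLT.2 (hβ (g l) (by simp))
    have hp' : ψ p = ∑ e ∈ p.support, p.coeff e • ∏ i, ψ (MvPolynomial.X i) ^ e i := by
      conv_lhs => rw [MvPolynomial.aeval_unique ψ, MvPolynomial.aeval_def, MvPolynomial.eval₂_eq']
      simp only [Algebra.smul_def, Function.comp_apply]
    rw [hp', Finset.sum_smul]
    refine Submodule.sum_mem _ fun e he => ?_
    rw [smul_assoc]
    refine Submodule.smul_mem _ _ (degreeLT_mono ?_ (prod_pow_smul_mem hc Finset.univ e hgl))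
    -- Degree at most `N` in each of `m` variables: the source of the factor `m` in `c * m`.
    have h1 : ∑ i, e i ≤ m * N := by
      have := Finset.sum_le_card_nsmul Finset.univ e N fun i _ =>
        (MvPolynomial.mem_restrictDegree _ _ _).1 hp e he i
      simpa using this
    have h2 := Nat.mul_le_mul_left c h1
    rw [mul_assoc]
    omega
  refine ⟨Fintype.card ι, c * m, β, fun N => ?_⟩
  rw [← finrank_degreeLT, ← finrank_restrictDegree K m N]
  have := finite_degreeLT ℳ (c * m * N + β + 1)
  let L : MvPolynomial.restrictDegree (Fin m) K N →ₗ[K] (ι → degreeLT ℳ (c * m * N + β + 1)) :=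
    LinearMap.pi fun l => LinearMap.codRestrict _
      ((LinearMap.toSpanSingleton S M (g l)).restrictScalars K ∘ₗ
        ψ.toLinearMap ∘ₗ (MvPolynomial.restrictDegree (Fin m) K N).subtype)
      fun p => hmem N p.1 p.2 l
  have hL : Function.Injective L := by
    refine (injective_iff_map_eq_zero L).2 fun p hp => Subtype.ext (hψ p.1 fun x => ?_)
    have hl : ∀ l, ψ p.1 • g l = 0 := fun l => congrArg Subtype.val (congrFun hp l)
    obtain ⟨e, rfl⟩ := hg x
    rw [Finset.smul_sum]
    exact Finset.sum_eq_zero fun l _ => by rw [smul_comm, hl l, smul_zero]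
  have h := LinearMap.finrank_le_finrank_of_injective hL
  rw [Module.finrank_pi_fintype] at h
  simpa using h

variable (ℳ) in
-- The old generators are `K`-combinations of finitely many homogeneous elements, so these generate
-- over the polynomial ring although `ψ` need not be graded.
theorem exists_homogeneous_of_exists_sum {t : ℕ} {e : Fin t → M}
    (he : ∀ x, ∃ c : Fin t → MvPolynomial (Fin m) K, ∑ l, ψ (c l) • e l = x) :
    ∃ G : Finset (M × ℕ), (∀ p ∈ G, p.1 ∈ ℳ p.2) ∧
      ∀ x, ∃ c : G → MvPolynomial (Fin m) K, ∑ l, ψ (c l) • l.1.1 = x := by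
  classical
  obtain ⟨G, hG, hTG⟩ := exists_homogeneous_span ℳ (Finset.univ.image e)
  refine ⟨G, hG, fun x => ?_⟩
  have hcoeff : ∀ j, ∃ k : G → K, ∑ l, k l • l.1.1 = e j := fun j =>
    (Submodule.mem_span_range_iff_exists_fun K).1 (hTG (by simp))
  choose k hk using hcoeff
  obtain ⟨c, rfl⟩ := he x
  refine ⟨fun l => ∑ j, k j l • c j, ?_⟩
  simp only [map_sum, map_smul, Finset.sum_smul, ← hk, Finset.smul_sum]
  rw [Finset.sum_comm]
  refine Finset.sum_congr rfl fun j _ => Finset.sum_congr rfl fun l _ => ?_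
  rw [smul_assoc, smul_comm]

end Growth

end GradedZeta

end

/-! ### Assembly of the algebraic and analytic parts -/

theorem theorem1p1 {K S M : Type*} [Field K] [CommRing S] [Algebra K S]
    (𝒜 : ℕ → Submodule K S) [GradedAlgebra 𝒜] (h𝒜 : 𝒜 0 = 1)
    {r : ℕ} (u : Fin r → S) (a : Fin r → ℕ) (ha : ∀ i, 0 < a i) (hu : ∀ i, u i ∈ 𝒜 (a i))
    (hgen : Algebra.adjoin K (Set.range u) = ⊤)
    [AddCommGroup M] [Module K M] [Module S M] [IsScalarTower K S M] [Module.Finite S M]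
    (ℳ : ℕ → Submodule K M) [DirectSum.Decomposition ℳ] [SetLike.GradedSMul 𝒜 ℳ]
    (m : ℕ) (hm : Module.supportDim S M = (m : WithBot ℕ∞))
    (D : ℕ) (hD : D = Finset.univ.lcm a) :
    (∀ n, Module.Finite K (ℳ n)) ∧
    (∃! d : Fin m → ℕ → ℚ,
      GradedZeta.IsHilbertQuasiPolynomial (GradedZeta.hilbertFunction ℳ) D m d) ∧
    ∀ d : Fin m → ℕ → ℚ,
      GradedZeta.IsHilbertQuasiPolynomial (GradedZeta.hilbertFunction ℳ) D m d →
      ∀ α : ℕ, α = GradedZeta.alphaIndex (GradedZeta.hilbertFunction ℳ) d →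
      ∀ w : ℝ, 0 < w →
        Differentiable ℂ (GradedZeta.theta (GradedZeta.hilbertFunction ℳ) α w) ∧
        ∃ ζM : ℂ → ℂ,
          -- `ζM` is the meromorphic continuation of the absolutely convergent zeta series
          MeromorphicOn ζM Set.univ ∧
          (∀ z : ℂ, (m : ℝ) < z.re →
            HasSum (GradedZeta.zetaTerm (GradedZeta.hilbertFunction ℳ) w z) (ζM z)) ∧
          -- there are no poles outside `{1, …, m}`, and the formula holds there
          (∀ z : ℂ, (∀ k : Fin m, z ≠ (k : ℂ) + 1) →
            AnalyticAt ℂ ζM z ∧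
            ζM z = GradedZeta.theta (GradedZeta.hilbertFunction ℳ) α w z +
              (D : ℂ) ^ (-z) * ∑ k : Fin m, ∑ j ∈ Finset.range D, (d k (j + α) : ℂ) *
                ∑ l ∈ Finset.range ((k : ℕ) + 1),
                  ((k : ℕ).choose l : ℂ) * (-(w : ℂ)) ^ l * (D : ℂ) ^ ((k : ℕ) - l) *
                    GradedZeta.hurwitz (z - (k : ℂ) + (l : ℂ))
                      (((j : ℝ) + (α : ℝ) + w) / (D : ℝ))) ∧
          -- the points `1, …, m` are at most simple poles, with the stated residues
          (∀ k : Fin m, GradedZeta.HasSimplePoleWithResidue ζM ((k : ℂ) + 1)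
            (1 / (D : ℂ) * ∑ l ∈ Finset.Ici k,
              ((l : ℕ).choose (k : ℕ) : ℂ) * (-(w : ℂ)) ^ ((l : ℕ) - (k : ℕ)) *
                ∑ j ∈ Finset.range D, (d l j : ℂ))) := by
  have hDpos : 0 < D := by
    rw [hD, Nat.pos_iff_ne_zero, Ne, Finset.lcm_eq_zero_iff]
    rintro ⟨i, -, hi⟩
    exact (ha i).ne' hi
  have hdvd : ∀ i, a i ∣ D := fun i => hD ▸ Finset.dvd_lcm (Finset.mem_univ i)
  have hft : Algebra.FiniteType K S := by
    classical
    exact ⟨⟨Finset.univ.image u, by simpa using hgen⟩⟩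
  have : IsNoetherianRing S := Algebra.FiniteType.isNoetherianRing K S
  have hfin : ∀ n, Module.Finite K (ℳ n) := GradedZeta.finite_component ℳ ha hu hgen
  obtain ⟨ψ, hψ, t, e, he⟩ := GradedZeta.exists_mvPolynomial_action K M hm
  obtain ⟨G, hG, hgG⟩ := GradedZeta.exists_homogeneous_of_exists_sum ℳ he
  refine ⟨hfin, GradedZeta.existsUnique_isHilbertQuasiPolynomial hDpos
    (GradedZeta.eventually_fwdDiff_iter_hilbertFunction hu hgen hdvd)
    (GradedZeta.exists_sum_hilbertFunction_le ha hu hgen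
      (g := fun p : G => p.1.1) (b := fun p => p.1.2) (fun p => hG p.1 p.2) hgG)
    (GradedZeta.exists_le_sum_hilbertFunction hu hgen he hψ), ?_⟩
  rintro d hd α rfl w hw
  exact ⟨GradedZeta.differentiable_theta hw, GradedZeta.zetaContinuation _ D d _ w,
    GradedZeta.meromorphicOn_zetaContinuation hDpos hd.periodic hw,
    fun z hz => GradedZeta.hasSum_zetaTerm hDpos hd.periodic
      (fun n hn => GradedZeta.eq_quasiEval_of_alphaIndex_le hd hn) hw hz,
    fun z hz => ⟨GradedZeta.analyticAt_zetaContinuation hDpos hw hz, rfl⟩,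
    fun k => GradedZeta.zetaContinuation_hasSimplePole hDpos hd.periodic hw k⟩
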